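/- Let $W$ be an oriented smooth 3-manifold carrying a Lorentzian Einstein–Weyl structure $([h],D)$: $[h]$ is a conformal class of metrics of signature $(2,1)$, $D$ is a torsion-free connection such that each $h\in[h]$ satisfies $Dh=\omega\otimes h$ for some one-form $\omega$ (so $\omega\mapsto\omega+2\,d\ln\psi$ when $h\mapsto\psi^2h$, $\psi>0$), and the symmetrised Ricci tensor of $D$ is proportional to $h$. Let $V$ be a function on $W$ of conformal weight $-1$ (that is, $V\mapsto\psi^{-1}V$ when $h\mapsto\psi^2h$), and let $A$ be a one-form on $W$, such that the (conformally invariant) generalised monopole equation $$*_h\,DV=dA,\qquad DV:=dV+\tfrac12\omega V,$$ holds. Let $h\in[h]$ be any representative for which $V>0$ and the $(++--)$ metric $$g=V\,h-V^{-1}(d\theta+A)^2\quad\text{on } W\times\mathbb R_\theta$$ is Ricci-flat ($V$ and $\omega$ being taken in the representative $h$). Then on $W\times\mathbb R_z$ the triple $$G=\sqrt V\,h+\frac1{\sqrt V}\,dz^2,\qquad \Phi=-\frac{\sqrt3}{4}\log V,\qquad F=*_h\,DV$$ satisfies the Einstein–Maxwell–dilaton equations of the Lagrangian density $R-2(\nabla\Phi)^2+\tfrac14e^{2\sqrt3\,\Phi}F_{\mu\nu}F^{\mu\nu}$,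 that is, $dF=0$ and $$R_{\mu\nu}-\tfrac12RG_{\mu\nu}=2\big(\nabla_\mu\Phi\nabla_\nu\Phi-\tfrac12(\nabla\Phi)^2G_{\mu\nu}\big)-\tfrac12e^{2\sqrt3\Phi}\big(F_{\mu\lambda}F_\nu{}^\lambda-\tfrac14F_{\alpha\beta}F^{\alpha\beta}G_{\mu\nu}\big),$$ $$\nabla_\mu\big(e^{2\sqrt3\Phi}F^{\mu\nu}\big)=0,\qquad 4\,\nabla^\mu\nabla_\mu\Phi+\tfrac{\sqrt3}{2}\,e^{2\sqrt3\Phi}F_{\mu\nu}F^{\mu\nu}=0 .$$ -/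

import Mathlib

open scoped Manifold ContDiff

noncomputable section

namespace EWKK

/-! ### Pseudo-Riemannian calculus in coordinates

`ι` is a finite set of coordinate labels; a coordinate domain is an open subset of `ι → ℝ`. -/

section Coordinates

variable {ι : Type*} [Fintype ι] [DecidableEq ι]

/-- The partial derivative `∂ᵢ f` at `y`. -/
def pd (i : ι) (f : (ι → ℝ) → ℝ) (y : ι → ℝ) : ℝ :=
  fderiv ℝ f y (Pi.single i 1)

/-- The Christoffel symbols `Γᵏᵢⱼ = ½ gᵏˡ (∂ᵢ gⱼₗ + ∂ⱼ gᵢₗ - ∂ₗ gᵢⱼ)` of the Levi-Civita connection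
of `g`; the arguments are in the order `k i j`. -/
def christoffel (g : (ι → ℝ) → Matrix ι ι ℝ) (y : ι → ℝ) (k i j : ι) : ℝ :=
  1 / 2 * ∑ l, (g y)⁻¹ k l *
    (pd i (fun z => g z j l) y + pd j (fun z => g z i l) y - pd l (fun z => g z i j) y)

/-- The Ricci tensor
`Rⱼₖ = ∂ᵢ Γⁱⱼₖ - ∂ⱼ Γⁱᵢₖ + Γⁱᵢₚ Γᵖⱼₖ - Γⁱⱼₚ Γᵖᵢₖ` of the connection `∇_{∂ᵢ} ∂ⱼ = Γᵏᵢⱼ ∂ₖ`, that is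
the trace of `X ↦ R(X, ∂ⱼ) ∂ₖ`. It is not symmetric for a general torsion-free connection. -/
def ricci (Γ : (ι → ℝ) → ι → ι → ι → ℝ) (y : ι → ℝ) (j k : ι) : ℝ :=
  ∑ i, (pd i (fun z => Γ z i j k) y - pd j (fun z => Γ z i i k) y
    + ∑ p, (Γ y i i p * Γ y p j k - Γ y i j p * Γ y p i k))

/-- The scalar curvature `R = gʲᵏ Rⱼₖ` of a metric. -/
def scalarCurv (g : (ι → ℝ) → Matrix ι ι ℝ) (y : ι → ℝ) : ℝ :=
  ∑ j, ∑ k, (g y)⁻¹ j k * ricci (christoffel g) y j k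

/-- `(∇f)² = gⁱʲ ∂ᵢf ∂ⱼf`. -/
def gradSq (g : (ι → ℝ) → Matrix ι ι ℝ) (f : (ι → ℝ) → ℝ) (y : ι → ℝ) : ℝ :=
  ∑ i, ∑ j, (g y)⁻¹ i j * (pd i f y * pd j f y)

/-- The wave operator `∇ⁱ∇ᵢ f = gⁱʲ (∂ᵢ∂ⱼ f - Γᵏᵢⱼ ∂ₖ f)`. -/
def box (g : (ι → ℝ) → Matrix ι ι ℝ) (f : (ι → ℝ) → ℝ) (y : ι → ℝ) : ℝ :=
  ∑ i, ∑ j, (g y)⁻¹ i j * (pd i (pd j f) y - ∑ k, christoffel g y k i j * pd k f y)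

/-- `Fᵃᵇ = gᵃᶜ gᵇᵈ F_{cd}`. -/
def raise (g F : (ι → ℝ) → Matrix ι ι ℝ) (y : ι → ℝ) (a b : ι) : ℝ :=
  ∑ c, ∑ d, (g y)⁻¹ a c * (g y)⁻¹ b d * F y c d

/-- `F_{ac} F_b{}^c = gᶜᵈ F_{ac} F_{bd}`. -/
def sqTensor (g F : (ι → ℝ) → Matrix ι ι ℝ) (y : ι → ℝ) (a b : ι) : ℝ :=
  ∑ c, ∑ d, (g y)⁻¹ c d * (F y a c * F y b d)

/-- `F² = F_{ab} Fᵃᵇ`. -/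
def formSq (g F : (ι → ℝ) → Matrix ι ι ℝ) (y : ι → ℝ) : ℝ :=
  ∑ a, ∑ b, F y a b * raise g F y a b

/-- The covariant divergence `∇ₐ Tᵃᵇ = ∂ₐ Tᵃᵇ + Γᵃₐ꜀ Tᶜᵇ + Γᵇₐ꜀ Tᵃᶜ`. -/
def divergence (g : (ι → ℝ) → Matrix ι ι ℝ) (T : (ι → ℝ) → ι → ι → ℝ) (y : ι → ℝ) (b : ι) : ℝ :=
  ∑ a, (pd a (fun z => T z a b) y
    + ∑ c, (christoffel g y a a c * T y c b + christoffel g y b a c * T y a c))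

/-- The Einstein-Maxwell-dilaton equations on the coordinate domain `U` for the metric `G`, the
dilaton `Φ` and the Maxwell field `F`: the Euler-Lagrange equations, with respect to `G`, a local
potential of the closed two-form `F`, and `Φ`, of the Lagrangian density
`√|det G| (R - 2 (∇Φ)² + κ exp(c Φ) F_{ab} Fᵃᵇ)`. -/
structure IsEMDSolution (κ c : ℝ) (G : (ι → ℝ) → Matrix ι ι ℝ) (Φ : (ι → ℝ) → ℝ)
    (F : (ι → ℝ) → Matrix ι ι ℝ) (U : Set (ι → ℝ)) : Prop where
  /-- `F` is a two-form. -/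
  antisymm : ∀ y ∈ U, ∀ a b, F y a b = -F y b a
  /-- `dF = 0`. -/
  closed : ∀ y ∈ U, ∀ a b d,
    pd a (fun z => F z b d) y + pd b (fun z => F z d a) y + pd d (fun z => F z a b) y = 0
  /-- The Einstein equation
  `R_{ab} - ½ R G_{ab} = 2 (∂ₐΦ ∂_bΦ - ½ (∇Φ)² G_{ab}) - 2 κ exp(c Φ) (F_{ac} F_b{}^c - ¼ F² G_{ab})`. -/
  einstein : ∀ y ∈ U, ∀ a b,
    ricci (christoffel G) y a b - 1 / 2 * scalarCurv G y * G y a b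
      = 2 * (pd a Φ y * pd b Φ y - 1 / 2 * gradSq G Φ y * G y a b)
        - 2 * κ * Real.exp (c * Φ y) * (sqTensor G F y a b - 1 / 4 * formSq G F y * G y a b)
  /-- The Maxwell equation `∇ₐ (exp(c Φ) Fᵃᵇ) = 0`. -/
  maxwell : ∀ y ∈ U, ∀ b,
    divergence G (fun z a' b' => Real.exp (c * Φ z) * raise G F z a' b') y b = 0
  /-- The dilaton equation `4 ∇ᵃ∇ₐ Φ + κ c exp(c Φ) F² = 0`. -/
  dilaton : ∀ y ∈ U, 4 * box G Φ y + κ * c * Real.exp (c * Φ y) * formSq G F y = 0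

end Coordinates

/-! ### Tensor fields on a three-manifold -/

/-- The model of three-dimensional manifolds. -/
abbrev I3 : ModelWithCorners ℝ (Fin 3 → ℝ) (Fin 3 → ℝ) := 𝓘(ℝ, Fin 3 → ℝ)

section Fields

variable {W : Type*} [TopologicalSpace W] [ChartedSpace (Fin 3 → ℝ) W]

/-- The smooth charts of `W`: all charts of its maximal smooth atlas. -/
def charts (W : Type*) [TopologicalSpace W] [ChartedSpace (Fin 3 → ℝ) W] :
    Set (OpenPartialHomeomorph W (Fin 3 → ℝ)) :=
  IsManifold.maximalAtlas I3 ∞ W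

/-- The coordinate vector field `∂ⱼ` of a chart `φ` (a junk value outside the chart domain). -/
def coordVec (φ : OpenPartialHomeomorph W (Fin 3 → ℝ)) (j : Fin 3) (x : W) : TangentSpace I3 x :=
  (mfderiv I3 I3 φ x).inverse (Pi.single j 1 : Fin 3 → ℝ)

/-- The components `αᵢ` of a field of covectors in a chart, at the point with coordinates `y`. -/
def comp1 (α : ∀ x : W, TangentSpace I3 x →L[ℝ] ℝ) (φ : OpenPartialHomeomorph W (Fin 3 → ℝ))
    (y : Fin 3 → ℝ) (i : Fin 3) : ℝ :=
  α (φ.symm y) (coordVec φ i (φ.symm y))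

/-- The components `hᵢⱼ` of a field of bilinear forms in a chart. -/
def comp2 (h : ∀ x : W, TangentSpace I3 x →L[ℝ] TangentSpace I3 x →L[ℝ] ℝ)
    (φ : OpenPartialHomeomorph W (Fin 3 → ℝ)) (y : Fin 3 → ℝ) : Matrix (Fin 3) (Fin 3) ℝ :=
  Matrix.of fun i j => h (φ.symm y) (coordVec φ i (φ.symm y)) (coordVec φ j (φ.symm y))

variable (W)

/-- Smooth one-forms. -/
structure OneForm where
  toFun : ∀ x : W, TangentSpace I3 x →L[ℝ] ℝ
  smooth : ∀ φ ∈ charts W, ∀ i, ContDiffOn ℝ ∞ (fun y => comp1 toFun φ y i) φ.target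

/-- Smooth metrics of signature `(2, 1)`. -/
structure LorentzMetric where
  toFun : ∀ x : W, TangentSpace I3 x →L[ℝ] TangentSpace I3 x →L[ℝ] ℝ
  symm : ∀ x u v, toFun x u v = toFun x v u
  /-- At every point there is an orthonormal frame with squared lengths `1, 1, -1`. -/
  lorentzian : ∀ x, ∃ e : Fin 3 → TangentSpace I3 x, ∀ i j,
    toFun x (e i) (e j) = if i = j then (if i = 2 then -1 else 1) else 0
  smooth : ∀ φ ∈ charts W, ∀ i j, ContDiffOn ℝ ∞ (fun y => comp2 toFun φ y i j) φ.target

/-- An orientation of `W`, given by a nowhere vanishing three-form; only the sign of the form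
is used. -/
structure OrientationForm where
  toFun : ∀ x : W, (TangentSpace I3 x) [⋀^Fin 3]→ₗ[ℝ] ℝ
  ne_zero : ∀ x, toFun x ≠ 0
  smooth : ∀ φ ∈ charts W,
    ContDiffOn ℝ ∞ (fun y => toFun (φ.symm y) fun i => coordVec φ i (φ.symm y)) φ.target

variable {W}

/-- The volume form of `h` for the orientation `o`: it takes the value `√|det h(vᵢ, vⱼ)|` on
positively oriented frames `v`. -/
def volForm (o : OrientationForm W) (h : LorentzMetric W) (x : W)
    (v : Fin 3 → TangentSpace I3 x) : ℝ :=
  Real.sign (o.toFun x v) *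
    Real.sqrt |(Matrix.of fun a b => h.toFun x (v a) (v b) : Matrix (Fin 3) (Fin 3) ℝ).det|

/-- The components `(*_h α)ⱼₖ = volᵢⱼₖ hⁱˡ αₗ` of the Hodge dual of a one-form. -/
def hodge (o : OrientationForm W) (h : LorentzMetric W) (α : ∀ x : W, TangentSpace I3 x →L[ℝ] ℝ)
    (φ : OpenPartialHomeomorph W (Fin 3 → ℝ)) (y : Fin 3 → ℝ) : Matrix (Fin 3) (Fin 3) ℝ :=
  Matrix.of fun j k => ∑ i, ∑ l,
    volForm o h (φ.symm y)
        ![coordVec φ i (φ.symm y), coordVec φ j (φ.symm y), coordVec φ k (φ.symm y)]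
      * (comp2 h.toFun φ y)⁻¹ i l * comp1 α φ y l

/-- The components `(dA)ⱼₖ = ∂ⱼ Aₖ - ∂ₖ Aⱼ` of the exterior derivative of a one-form. -/
def extDeriv1 (A : OneForm W) (φ : OpenPartialHomeomorph W (Fin 3 → ℝ)) (y : Fin 3 → ℝ) :
    Matrix (Fin 3) (Fin 3) ℝ :=
  Matrix.of fun j k =>
    pd j (fun z => comp1 A.toFun φ z k) y - pd k (fun z => comp1 A.toFun φ z j) y

/-- `IsRescaling h h' ψ`: `ψ` is a smooth positive function and `h' = ψ² h`. -/
def IsRescaling (h h' : LorentzMetric W) (ψ : W → ℝ) : Prop :=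
  ContMDiff I3 𝓘(ℝ, ℝ) ∞ ψ ∧ (∀ x, 0 < ψ x) ∧ ∀ x, h'.toFun x = (ψ x ^ 2) • h.toFun x

end Fields

/-! ### Einstein-Weyl structures -/

section EinsteinWeyl

/-- Affine connections on `W`: covariant derivatives on the tangent bundle. -/
abbrev AffineConnection (W : Type*) [TopologicalSpace W] [ChartedSpace (Fin 3 → ℝ) W]
    [IsManifold I3 ∞ W] : Type _ :=
  CovariantDerivative I3 (Fin 3 → ℝ) (TangentSpace I3 : W → Type _)

variable {W : Type*} [TopologicalSpace W] [ChartedSpace (Fin 3 → ℝ) W] [IsManifold I3 ∞ W]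

/-- `D h = w ⊗ h`, that is `X (h(Y, Z)) - h(D_X Y, Z) - h(Y, D_X Z) = w(X) h(Y, Z)`.
Here `D Y x X` is `D_X Y` at `x`. -/
def WeylCompatible (D : AffineConnection W) (h : LorentzMetric W) (w : OneForm W) : Prop :=
  ∀ (x : W) (Y Z : ∀ p : W, TangentSpace I3 p),
    MDifferentiableAt I3 I3.tangent (fun p => (⟨p, Y p⟩ : TangentBundle I3 W)) x →
    MDifferentiableAt I3 I3.tangent (fun p => (⟨p, Z p⟩ : TangentBundle I3 W)) x →
    ∀ X : TangentSpace I3 x,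
      mvfderiv I3 (fun p => h.toFun p (Y p) (Z p)) x X
        - h.toFun x (D Y x X) (Z x) - h.toFun x (Y x) (D Z x X)
      = w.toFun x X * h.toFun x (Y x) (Z x)

/-- The coefficients of `D` in a chart, `D_{∂ᵢ} ∂ⱼ = γᵏᵢⱼ ∂ₖ`, in the order `k i j`. -/
def connCoeff (D : AffineConnection W) (φ : OpenPartialHomeomorph W (Fin 3 → ℝ))
    (y : Fin 3 → ℝ) (k i j : Fin 3) : ℝ :=
  (mfderiv I3 I3 φ (φ.symm y)
    (D (coordVec φ j) (φ.symm y) (coordVec φ i (φ.symm y))) : Fin 3 → ℝ) k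

variable (W) in
/-- A Lorentzian Einstein-Weyl structure on `W`. -/
structure EinsteinWeylStructure where
  /-- The conformal structure: a full conformal class of metrics of signature `(2, 1)`. -/
  cls : Set (LorentzMetric W)
  cls_nonempty : cls.Nonempty
  mem_cls_iff : ∀ h ∈ cls, ∀ h', h' ∈ cls ↔ ∃ ψ, IsRescaling h h' ψ
  /-- The Weyl connection. -/
  D : AffineConnection W
  torsion_free : haveI : IsManifold I3 2 W := IsManifold.of_le (n := ∞) (by norm_cast)
    D.torsion = 0
  weyl : ∀ h ∈ cls, ∃ w : OneForm W, WeylCompatible D h w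
  /-- The symmetrised Ricci tensor of `D` is proportional to the metrics of the class. -/
  einstein_weyl : ∀ h ∈ cls, ∃ Λ : W → ℝ, ∀ φ ∈ charts W, ∀ y ∈ φ.target, ∀ i j,
    1 / 2 * (ricci (connCoeff D φ) y i j + ricci (connCoeff D φ) y j i)
      = Λ (φ.symm y) * comp2 h.toFun φ y i j

/-- Smooth functions of conformal weight `m` on an Einstein-Weyl space: a function for every metric
of the conformal class, multiplied by `ψᵐ` under `h ↦ ψ² h`. -/
structure WeightedFunction (S : EinsteinWeylStructure W) (m : ℤ) where
  toFun : S.cls → W → ℝ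
  smooth : ∀ h, ContMDiff I3 𝓘(ℝ, ℝ) ∞ (toFun h)
  rescale : ∀ (h h' : S.cls) (ψ : W → ℝ), IsRescaling h.1 h'.1 ψ →
    ∀ x, toFun h' x = ψ x ^ m * toFun h x

/-- The Weyl derivative `D V = dV - (m/2) V w` of a function of weight `m`, in the representative
`h` with `D h = w ⊗ h`. For `m = -1` it is `dV + ½ w V`. -/
def WeightedFunction.weylDeriv {S : EinsteinWeylStructure W} {m : ℤ} (V : WeightedFunction S m)
    (h : S.cls) (w : OneForm W) (x : W) : TangentSpace I3 x →L[ℝ] ℝ :=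
  mvfderiv I3 (V.toFun h) x - ((m : ℝ) / 2 * V.toFun h x) • w.toFun x

/-- The generalised monopole equation `*_h (dV + ½ w V) = dA`. The equation is conformally
invariant and is stated in all the representatives `(h, w)`. -/
def IsMonopole (S : EinsteinWeylStructure W) (o : OrientationForm W)
    (V : WeightedFunction S (-1)) (A : OneForm W) : Prop :=
  ∀ (h : S.cls) (w : OneForm W), WeylCompatible S.D h.1 w →
    ∀ φ ∈ charts W, ∀ y ∈ φ.target, hodge o h.1 (V.weylDeriv h w) φ y = extDeriv1 A φ y

end EinsteinWeyl

/-! ### Fields on `W × ℝ`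

A chart `φ` of `W` and the coordinate of the line give coordinates on `W × ℝ`, labelled by
`Fin 3 ⊕ Unit`. These product charts cover `W × ℝ`, and the equations below are tensorial, so it
suffices to state them in these charts. -/

section Product

variable {W : Type*} [TopologicalSpace W] [ChartedSpace (Fin 3 → ℝ) W]

/-- The coordinates on `W` of a point of `W × ℝ`. -/
def baseCoord (q : Fin 3 ⊕ Unit → ℝ) : Fin 3 → ℝ := fun i => q (Sum.inl i)

/-- The coordinate domain in `W × ℝ` of a chart of `W`. -/
def prodDomain (φ : OpenPartialHomeomorph W (Fin 3 → ℝ)) : Set (Fin 3 ⊕ Unit → ℝ) :=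
  {q | baseCoord q ∈ φ.target}

/-- The metric `g = V h - V⁻¹ (dθ + A)²` in the coordinates `(y, θ)`. -/
def gMetric (h : LorentzMetric W) (V : W → ℝ) (A : OneForm W)
    (φ : OpenPartialHomeomorph W (Fin 3 → ℝ)) (q : Fin 3 ⊕ Unit → ℝ) :
    Matrix (Fin 3 ⊕ Unit) (Fin 3 ⊕ Unit) ℝ :=
  let y := baseCoord q
  let v := V (φ.symm y)
  Matrix.fromBlocks
    (Matrix.of fun i j =>
      v * comp2 h.toFun φ y i j - v⁻¹ * (comp1 A.toFun φ y i * comp1 A.toFun φ y j))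
    (Matrix.of fun i _ => -(v⁻¹ * comp1 A.toFun φ y i))
    (Matrix.of fun _ j => -(v⁻¹ * comp1 A.toFun φ y j))
    (Matrix.of fun _ _ => -v⁻¹)

/-- The metric `g = V h - V⁻¹ (dθ + A)²` on `W × ℝ` is Ricci-flat. -/
def IsRicciFlat (h : LorentzMetric W) (V : W → ℝ) (A : OneForm W) : Prop :=
  ∀ φ ∈ charts W, ∀ q ∈ prodDomain φ, ∀ a b, ricci (christoffel (gMetric h V A φ)) q a b = 0

/-- The metric `G = √V h + (1/√V) dz²` in the coordinates `(y, z)`. -/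
def GMetric (h : LorentzMetric W) (V : W → ℝ)
    (φ : OpenPartialHomeomorph W (Fin 3 → ℝ)) (q : Fin 3 ⊕ Unit → ℝ) :
    Matrix (Fin 3 ⊕ Unit) (Fin 3 ⊕ Unit) ℝ :=
  Matrix.fromBlocks
    (Real.sqrt (V (φ.symm (baseCoord q))) • comp2 h.toFun φ (baseCoord q)) 0
    0 (Matrix.of fun _ _ => 1 / Real.sqrt (V (φ.symm (baseCoord q))))

/-- The dilaton `Φ = -(√3/4) log V`. -/
def dilatonField (V : W → ℝ) (φ : OpenPartialHomeomorph W (Fin 3 → ℝ))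
    (q : Fin 3 ⊕ Unit → ℝ) : ℝ :=
  -(Real.sqrt 3 / 4) * Real.log (V (φ.symm (baseCoord q)))

/-- The pull-back to `W × ℝ` of a two-form on `W` with components `f` in the chart. -/
def pullTwoForm (f : (Fin 3 → ℝ) → Matrix (Fin 3) (Fin 3) ℝ) (q : Fin 3 ⊕ Unit → ℝ) :
    Matrix (Fin 3 ⊕ Unit) (Fin 3 ⊕ Unit) ℝ :=
  Matrix.fromBlocks (f (baseCoord q)) 0 0 0

end Product

end EWKK

end

set_option linter.unusedSectionVars false

noncomputable section

/-! In a chart put `s = log V`. Both four-metrics then belong to one family, `exp(s) h + ε exp(-s)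
(dθ + A)²`: the metric g is the member with `ε = -1` and data `(s, A)`, while G is the member with
`ε = 1` and data `(s/2, 0)`. The Ricci tensor of the whole family is computed once, in the frame `eᵢ
= ∂ᵢ - Aᵢ ∂_θ`, `e_θ = ∂_θ`, in which nothing depends on the fibre coordinate and A enters only
through `F = dA`.

With indices moved by h, its components are as follows (`frameRicci_inr_inr`, `frameRicci_inl_inr`,
`frameRicci_inl_inl`): `R_θθ = (ε/2) e^{-2s} □s + (1/4) e^{-4s} F²`; `R_jθ = (ε/2) ∇ᵢ(e^{-2s} Fⱼⁱ)`;
`R_jk = Ric(h)_jk - (1/2) h_jk □s - (1/2) ∂ⱼs ∂ₖs - (ε/2) e^{-2s} F_jp F_kᵖ`.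

For g all three vanish. The first yields a wave equation for s with source `F²` (`box_of_flat`), the
second the Maxwell equation weighted by `e^{-2s}` (`maxwell_of_flat`), and the third expresses
`Ric(h)` through s and F. Substituting these into the same formulas for G gives the Einstein
equation in trace-reversed form (`ricci_emd`). The Maxwell and dilaton equations of G are the other
two equations with the powers of `e^s` redistributed (`maxwell_emd`, `dilaton_emd`). The monopole
equation identifies the Maxwell field with dA, which also makes it closed. -/

namespace EWKK

/-! ### Calculus and smoothness of partial derivatives. -/

section PartialDerivatives

variable {ι : Type*} [Fintype ι] [DecidableEq ι] {f g : (ι → ℝ) → ℝ} {y : ι → ℝ}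

lemma pd_congr {i : ι} (hfg : f =ᶠ[nhds y] g) : pd i f y = pd i g y := by
  unfold pd; rw [hfg.fderiv_eq]

lemma pd_congr_of_eqOn {U : Set (ι → ℝ)} (hU : IsOpen U) (hy : y ∈ U) {i : ι}
    (hfg : ∀ z ∈ U, f z = g z) : pd i f y = pd i g y :=
  pd_congr (Filter.eventuallyEq_of_mem (hU.mem_nhds hy) hfg)

lemma pd_const (i : ι) (c : ℝ) : pd i (fun _ => c) y = 0 := by
  simp [pd]

lemma pd_add (i : ι) (hf : DifferentiableAt ℝ f y) (hg : DifferentiableAt ℝ g y) :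
    pd i (fun z => f z + g z) y = pd i f y + pd i g y := by
  unfold pd; rw [fderiv_fun_add hf hg]; rfl

lemma pd_sub (i : ι) (hf : DifferentiableAt ℝ f y) (hg : DifferentiableAt ℝ g y) :
    pd i (fun z => f z - g z) y = pd i f y - pd i g y := by
  unfold pd; rw [fderiv_fun_sub hf hg]; rfl

lemma pd_neg (i : ι) : pd i (fun z => -f z) y = -pd i f y := by
  unfold pd; rw [fderiv_fun_neg]; rfl

lemma pd_mul (i : ι) (hf : DifferentiableAt ℝ f y) (hg : DifferentiableAt ℝ g y) :
    pd i (fun z => f z * g z) y = pd i f y * g y + f y * pd i g y := by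
  unfold pd; rw [fderiv_fun_mul hf hg]; simp; ring

lemma pd_const_mul (i : ι) (c : ℝ) (hf : DifferentiableAt ℝ f y) :
    pd i (fun z => c * f z) y = c * pd i f y := by
  rw [pd_mul i (by fun_prop) hf, pd_const]; ring

lemma pd_sum (i : ι) {κ : Type*} (s : Finset κ) {F : κ → (ι → ℝ) → ℝ}
    (hF : ∀ k ∈ s, DifferentiableAt ℝ (F k) y) :
    pd i (fun z => ∑ k ∈ s, F k z) y = ∑ k ∈ s, pd i (F k) y := by
  unfold pd
  rw [fderiv_fun_sum hF]
  simp

lemma pd_comm (i j : ι) (hf : ContDiffAt ℝ ∞ f y) : pd i (pd j f) y = pd j (pd i f) y := by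
  have hd : DifferentiableAt ℝ (fderiv ℝ f) y :=
    (hf.fderiv_right (m := 1) (by norm_cast)).differentiableAt (by norm_num)
  have key : ∀ a b : ι,
      pd a (pd b f) y = fderiv ℝ (fderiv ℝ f) y (Pi.single a 1) (Pi.single b 1) := by
    intro a b
    unfold pd
    rw [fderiv_clm_apply hd (by fun_prop)]
    simp
  rw [key, key]
  exact (hf.isSymmSndFDerivAt (by simp; norm_cast)).eq _ _

lemma contDiffOn_pd {U : Set (ι → ℝ)} (hU : IsOpen U) (hf : ContDiffOn ℝ ∞ f U) (i : ι) :
    ContDiffOn ℝ ∞ (pd i f) U := by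
  have := hf.fderiv_of_isOpen hU (m := ∞) (by norm_cast)
  unfold pd
  exact this.clm_apply contDiffOn_const

lemma contDiffOn_det {U : Set (ι → ℝ)} {κ : Type*} [Fintype κ] [DecidableEq κ]
    {m : (ι → ℝ) → Matrix κ κ ℝ} (hm : ∀ i j, ContDiffOn ℝ ∞ (fun y => m y i j) U) :
    ContDiffOn ℝ ∞ (fun y => (m y).det) U := by
  simp only [Matrix.det_apply]
  refine ContDiffOn.sum fun σ _ => ?_
  simp only [Units.smul_def, zsmul_eq_mul]
  exact contDiffOn_const.mul (contDiffOn_prod fun i _ => hm _ _)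

/-- Cramer's rule: an entry of the inverse is a quotient of two determinants with smooth entries. -/
lemma contDiffOn_inv_apply {U : Set (ι → ℝ)} {κ : Type*} [Fintype κ] [DecidableEq κ]
    {m : (ι → ℝ) → Matrix κ κ ℝ} (hm : ∀ i j, ContDiffOn ℝ ∞ (fun y => m y i j) U)
    (h0 : ∀ y ∈ U, (m y).det ≠ 0) (i j : κ) :
    ContDiffOn ℝ ∞ (fun y => (m y)⁻¹ i j) U := by
  have h1 : ∀ y, (m y)⁻¹ i j = ((m y).det)⁻¹ * ((m y).updateRow j (Pi.single i 1)).det := by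
    intro y
    rw [Matrix.inv_def, Matrix.smul_apply, Matrix.adjugate_apply, Ring.inverse_eq_inv', smul_eq_mul]
  simp only [h1]
  refine ((contDiffOn_det hm).inv h0).mul (contDiffOn_det fun a b => ?_)
  by_cases hab : a = j
  · subst hab; simpa using contDiffOn_const
  · simpa [Matrix.updateRow_ne hab] using hm a b

end PartialDerivatives

/-! ### Functions and connections pulled back from the base. -/

lemma hasFDerivAt_baseCoord (q : Fin 3 ⊕ Unit → ℝ) :
    HasFDerivAt baseCoord
      (ContinuousLinearMap.pi fun i => ContinuousLinearMap.proj (R := ℝ) (Sum.inl i : Fin 3 ⊕ Unit))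
      q :=
  (ContinuousLinearMap.pi fun i =>
    ContinuousLinearMap.proj (R := ℝ) (φ := fun _ => ℝ) (Sum.inl i : Fin 3 ⊕ Unit)).hasFDerivAt

lemma continuous_baseCoord : Continuous baseCoord := by
  unfold baseCoord; fun_prop

/-- The partial derivative of a pulled back function. -/
def basePd (a : Fin 3 ⊕ Unit) (f : (Fin 3 → ℝ) → ℝ) (y : Fin 3 → ℝ) : ℝ :=
  match a with
  | .inl i => pd i f y
  | .inr _ => 0

lemma pd_baseCoord (a : Fin 3 ⊕ Unit) {f : (Fin 3 → ℝ) → ℝ} {q : Fin 3 ⊕ Unit → ℝ}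
    (hf : DifferentiableAt ℝ f (baseCoord q)) :
    pd a (fun p => f (baseCoord p)) q = basePd a f (baseCoord q) := by
  have h1 := hf.hasFDerivAt.comp q (hasFDerivAt_baseCoord q)
  have h2 : pd a (fun p => f (baseCoord p)) q = _ :=
    congrArg (fun L => L (Pi.single a 1)) h1.fderiv
  rw [h2]
  rcases a with i | u
  · simp only [ContinuousLinearMap.comp_apply, basePd, pd]
    congr 1
    ext j
    simp [Pi.single_apply]
  · simp only [ContinuousLinearMap.comp_apply, basePd]
    rw [show (ContinuousLinearMap.pi fun i => ContinuousLinearMap.proj (R := ℝ)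
        (φ := fun _ => ℝ) (Sum.inl i : Fin 3 ⊕ Unit)) (Pi.single (Sum.inr u) 1) = 0 by
      ext j; simp, map_zero]

/-- The Ricci tensor of a connection on `W × ℝ` whose coefficients are pulled back from `W`. -/
def baseRicci (c : (Fin 3 → ℝ) → Fin 3 ⊕ Unit → Fin 3 ⊕ Unit → Fin 3 ⊕ Unit → ℝ) (y : Fin 3 → ℝ)
    (j k : Fin 3 ⊕ Unit) : ℝ :=
  ∑ i, (basePd i (fun z => c z i j k) y - basePd j (fun z => c z i i k) y
    + ∑ p, (c y i i p * c y p j k - c y i j p * c y p i k))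

lemma ricci_eq_baseRicci {U : Set (Fin 3 → ℝ)} (hU : IsOpen U)
    {Γ : (Fin 3 ⊕ Unit → ℝ) → Fin 3 ⊕ Unit → Fin 3 ⊕ Unit → Fin 3 ⊕ Unit → ℝ}
    {c : (Fin 3 → ℝ) → Fin 3 ⊕ Unit → Fin 3 ⊕ Unit → Fin 3 ⊕ Unit → ℝ}
    (hΓ : ∀ q, baseCoord q ∈ U → Γ q = c (baseCoord q))
    {q : Fin 3 ⊕ Unit → ℝ} (hq : baseCoord q ∈ U)
    (hc : ∀ i j k, DifferentiableAt ℝ (fun z => c z i j k) (baseCoord q)) (j k : Fin 3 ⊕ Unit) :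
    ricci Γ q j k = baseRicci c (baseCoord q) j k := by
  have hpd : ∀ l a b d, pd l (fun z => Γ z a b d) q = basePd l (fun z => c z a b d) (baseCoord q) := by
    intro l a b d
    rw [← pd_baseCoord l (hc a b d)]
    exact pd_congr_of_eqOn (hU.preimage continuous_baseCoord) hq fun z hz => by rw [hΓ z hz]
  simp only [ricci, baseRicci, hpd, hΓ q hq]

/-! ### Change to the frame adapted to the fibration. -/

/-- The components of `∇_{∂ₐ} ∂_b` along the frame `eᵢ = ∂ᵢ - Aᵢ ∂_θ`, `e_θ = ∂_θ`, up to the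
derivative of `A`, in terms of the coefficients `o` of the connection in this frame. -/
def frameSum (o : Fin 3 ⊕ Unit → Fin 3 ⊕ Unit → Fin 3 ⊕ Unit → ℝ) (A : Fin 3 ⊕ Unit → ℝ)
    (c a b : Fin 3 ⊕ Unit) : ℝ :=
  o c a b + A b * o c a (.inr ()) + A a * o c (.inr ()) b + A a * A b * o c (.inr ()) (.inr ())

/-- A covector on `W`, as a covector on `W × ℝ`. -/
def extCov (v : Fin 3 → ℝ) : Fin 3 ⊕ Unit → ℝ := Sum.elim v 0

/-- The coefficients in the frame `∂ₐ` of the connection with coefficients `o` in the frame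
`eᵢ = ∂ᵢ - Aᵢ ∂_θ`, `e_θ = ∂_θ`. -/
def frameConn (o : (Fin 3 → ℝ) → Fin 3 ⊕ Unit → Fin 3 ⊕ Unit → Fin 3 ⊕ Unit → ℝ)
    (A : (Fin 3 → ℝ) → Fin 3 → ℝ) (y : Fin 3 → ℝ) (c a b : Fin 3 ⊕ Unit) : ℝ :=
  match c with
  | .inl k => frameSum (o y) (extCov (A y)) (.inl k) a b
  | .inr _ => frameSum (o y) (extCov (A y)) (.inr ()) a b
      + basePd a (fun z => extCov (A z) b) y
      - ∑ k, A y k * frameSum (o y) (extCov (A y)) (.inl k) a b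

/-- The components `Fᵢⱼ = ∂ᵢ Aⱼ - ∂ⱼ Aᵢ`. -/
def curl (A : (Fin 3 → ℝ) → Fin 3 → ℝ) (y : Fin 3 → ℝ) (i j : Fin 3) : ℝ :=
  pd i (fun z => A z j) y - pd j (fun z => A z i) y

/-- The Ricci tensor in the frame `eᵢ = ∂ᵢ - Aᵢ ∂_θ`, `e_θ = ∂_θ`, which satisfies
`[eᵢ, eⱼ] = -Fᵢⱼ e_θ`. -/
def frameRicci (o : (Fin 3 → ℝ) → Fin 3 ⊕ Unit → Fin 3 ⊕ Unit → Fin 3 ⊕ Unit → ℝ)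
    (A : (Fin 3 → ℝ) → Fin 3 → ℝ) (y : Fin 3 → ℝ) (j k : Fin 3 ⊕ Unit) : ℝ :=
  baseRicci o y j k + match j with
    | .inl j => ∑ i, curl A y i j * o y (.inl i) (.inr ()) k
    | .inr _ => 0

section Frame

variable {o : (Fin 3 → ℝ) → Fin 3 ⊕ Unit → Fin 3 ⊕ Unit → Fin 3 ⊕ Unit → ℝ}
  {A : (Fin 3 → ℝ) → Fin 3 → ℝ} {y : Fin 3 → ℝ}

lemma differentiableAt_extCov (hA : ∀ i, DifferentiableAt ℝ (fun z => A z i) y) (b : Fin 3 ⊕ Unit) :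
    DifferentiableAt ℝ (fun z => extCov (A z) b) y := by
  rcases b with i | u
  · exact hA i
  · exact differentiableAt_const _

lemma differentiableAt_frameSum (ho : ∀ c a b, DifferentiableAt ℝ (fun z => o z c a b) y)
    (hA : ∀ i, DifferentiableAt ℝ (fun z => A z i) y) (c a b : Fin 3 ⊕ Unit) :
    DifferentiableAt ℝ (fun z => frameSum (o z) (extCov (A z)) c a b) y := by
  have hA' := differentiableAt_extCov hA
  unfold frameSum
  fun_prop

lemma differentiableAt_frameConn (ho : ∀ c a b, DifferentiableAt ℝ (fun z => o z c a b) y)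
    (hA : ∀ i, DifferentiableAt ℝ (fun z => A z i) y)
    (hdA : ∀ i j, DifferentiableAt ℝ (pd i fun z => A z j) y) (c a b : Fin 3 ⊕ Unit) :
    DifferentiableAt ℝ (fun z => frameConn o A z c a b) y := by
  have h1 := differentiableAt_frameSum ho hA
  have h2 : DifferentiableAt ℝ (fun z => basePd a (fun z => extCov (A z) b) z) y := by
    rcases a with i | u
    · rcases b with j | v
      · exact hdA i j
      · simp only [basePd, extCov, Sum.elim_inr, Pi.zero_apply, pd_const]
        fun_prop
    · simp only [basePd]
      fun_prop
  rcases c with k | u <;> simp only [frameConn] <;> fun_prop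

lemma pd_frameSum (ho : ∀ c a b, DifferentiableAt ℝ (fun z => o z c a b) y)
    (hA : ∀ i, DifferentiableAt ℝ (fun z => A z i) y) (l : Fin 3) (c a b : Fin 3 ⊕ Unit) :
    pd l (fun z => frameSum (o z) (extCov (A z)) c a b) y
      = frameSum (fun c a b => pd l (fun z => o z c a b) y) (extCov (A y)) c a b
        + pd l (fun z => extCov (A z) b) y * (o y c a (.inr ()) + extCov (A y) a * o y c (.inr ()) (.inr ()))
        + pd l (fun z => extCov (A z) a) y * (o y c (.inr ()) b
            + extCov (A y) b * o y c (.inr ()) (.inr ())) := by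
  have hA' := differentiableAt_extCov hA
  unfold frameSum
  simp (disch := fun_prop) only [pd_add, pd_mul]
  ring

/-- These are the only coefficients with upper fibre index whose derivative enters the Ricci tensor.
Their first lower index is also the fibre, so the term `∂ₐ A_b` is absent, and no second derivative
of A ever appears. -/
lemma pd_frameConn_fibre (ho : ∀ c a b, DifferentiableAt ℝ (fun z => o z c a b) y)
    (hA : ∀ i, DifferentiableAt ℝ (fun z => A z i) y) (l : Fin 3) (b : Fin 3 ⊕ Unit) :
    pd l (fun z => frameConn o A z (.inr ()) (.inr ()) b) y
      = pd l (fun z => frameSum (o z) (extCov (A z)) (.inr ()) (.inr ()) b) y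
        - ∑ k, (pd l (fun z => A z k) y * frameSum (o y) (extCov (A y)) (.inl k) (.inr ()) b
          + A y k * pd l (fun z => frameSum (o z) (extCov (A z)) (.inl k) (.inr ()) b) y) := by
  have h1 := differentiableAt_frameSum ho hA
  simp only [frameConn, basePd]
  simp (disch := fun_prop) only [pd_sub, pd_add, pd_mul, pd_const, pd_sum]
  ring

lemma extCov_inl (v : Fin 3 → ℝ) (i : Fin 3) : extCov v (.inl i) = v i := rfl

lemma extCov_inr (v : Fin 3 → ℝ) (u : Unit) : extCov v (.inr u) = 0 := rfl

/-- Tensoriality of the Ricci tensor under `∂ₐ = eₐ + Aₐ e_θ`, where `A_θ = 0`. The noncommutativity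
of the frame is absorbed in `frameRicci`. The identity holds for arbitrary coefficients `o`, with no
metric or symmetry involved. -/
lemma baseRicci_frameConn (ho : ∀ c a b, DifferentiableAt ℝ (fun z => o z c a b) y)
    (hA : ∀ i, DifferentiableAt ℝ (fun z => A z i) y) (j k : Fin 3 ⊕ Unit) :
    baseRicci (frameConn o A) y j k
      = frameRicci o A y j k + extCov (A y) k * frameRicci o A y j (.inr ())
        + extCov (A y) j * frameRicci o A y (.inr ()) k
        + extCov (A y) j * extCov (A y) k * frameRicci o A y (.inr ()) (.inr ()) := by
  have h1 : ∀ (l i : Fin 3) (a b : Fin 3 ⊕ Unit), pd l (fun z => frameConn o A z (.inl i) a b) y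
      = _ := fun l i => pd_frameSum ho hA l (.inl i)
  rcases j with j | ⟨⟩ <;> rcases k with k | ⟨⟩ <;>
  · simp only [baseRicci, frameRicci, Fintype.sum_sum_type, Finset.univ_unique,
      Finset.sum_singleton, PUnit.default_eq_unit, basePd, h1, pd_frameConn_fibre ho hA,
      pd_frameSum ho hA]
    simp only [frameConn, frameSum, extCov_inl, extCov_inr, basePd, Fin.sum_univ_three, curl,
      pd_const]
    -- What remains is a polynomial identity in the values and first derivatives at `y`.
    generalize o y = o'
    ring

end Frame

/-! ### Levi-Civita calculus of a general metric. -/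

section Metric

variable {ι : Type*} [Fintype ι] [DecidableEq ι] {g : (ι → ℝ) → Matrix ι ι ℝ} {y : ι → ℝ}

/-- Nondegeneracy lets Christoffel symbols be recognised from the Koszul formula with the upper
index lowered, so a candidate can be checked without using the inverse metric. -/
lemma christoffel_eq_of_lower (h1 : (g y)⁻¹ * g y = 1) {i j : ι} {X : ι → ℝ}
    (hX : ∀ l, pd i (fun z => g z j l) y + pd j (fun z => g z i l) y - pd l (fun z => g z i j) y
      = 2 * ∑ m, g y l m * X m) (k : ι) :
    christoffel g y k i j = X k := by
  have h2 : (g y)⁻¹.mulVec ((g y).mulVec X) = X := by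
    rw [Matrix.mulVec_mulVec, h1, Matrix.one_mulVec]
  rw [christoffel, ← congrFun h2 k]
  simp only [hX, Matrix.mulVec, dotProduct, Finset.mul_sum]
  exact Finset.sum_congr rfl fun l _ => Finset.sum_congr rfl fun m _ => by ring

lemma sum_mul_christoffel (h1 : g y * (g y)⁻¹ = 1) (l i j : ι) :
    ∑ k, g y l k * christoffel g y k i j = 1 / 2 *
      (pd i (fun z => g z j l) y + pd j (fun z => g z i l) y - pd l (fun z => g z i j) y) := by
  set X : ι → ℝ := fun l =>
    pd i (fun z => g z j l) y + pd j (fun z => g z i l) y - pd l (fun z => g z i j) y with hX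
  have h2 : (g y).mulVec ((g y)⁻¹.mulVec X) = X := by
    rw [Matrix.mulVec_mulVec, h1, Matrix.one_mulVec]
  change _ = 1 / 2 * X l
  rw [← congrFun h2 l]
  simp only [christoffel, Matrix.mulVec, dotProduct, Finset.mul_sum]
  exact Finset.sum_congr rfl fun l _ => Finset.sum_congr rfl fun m _ => by ring

lemma christoffel_symm (hs : ∀ z i j, g z i j = g z j i) (k i j : ι) :
    christoffel g y k i j = christoffel g y k j i := by
  unfold christoffel
  congr 1
  refine Finset.sum_congr rfl fun l _ => ?_
  rw [show (fun z => g z i j) = fun z => g z j i from funext fun z => hs z i j]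
  ring

/-- Metric compatibility `∇g = 0`: adding two lowered Christoffel symbols cancels all but one
derivative. -/
lemma pd_metric (h1 : g y * (g y)⁻¹ = 1) (hs : ∀ z i j, g z i j = g z j i) (l i j : ι) :
    pd l (fun z => g z i j) y
      = ∑ m, (g y j m * christoffel g y m l i + g y i m * christoffel g y m l j) := by
  rw [Finset.sum_add_distrib, sum_mul_christoffel h1, sum_mul_christoffel h1]
  rw [show (fun z => g z j i) = fun z => g z i j from funext fun z => hs z j i,
    show (fun z => g z l i) = fun z => g z i l from funext fun z => hs z l i,
    show (fun z => g z l j) = fun z => g z j l from funext fun z => hs z l j]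
  ring

lemma inv_symm (hs : ∀ z i j, g z i j = g z j i) (i j : ι) : (g y)⁻¹ i j = (g y)⁻¹ j i := by
  have h1 : (g y).transpose = g y := by ext a b; exact hs y b a
  conv_rhs => rw [← Matrix.transpose_apply (g y)⁻¹, Matrix.transpose_nonsing_inv, h1]

/-- Differentiating `g⁻¹ g = 1` gives `∂g⁻¹ = -g⁻¹ (∂g) g⁻¹`, into which `∇g = 0` is substituted.
The open set is needed because the product is known to be 1 only there. -/
lemma pd_inv_metric {U : Set (ι → ℝ)} (hU : IsOpen U) (hy : y ∈ U)
    (h1 : ∀ z ∈ U, (g z)⁻¹ * g z = 1)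
    (hs : ∀ z i j, g z i j = g z j i) (hd : ∀ i j, DifferentiableAt ℝ (fun z => g z i j) y)
    (hd' : ∀ i j, DifferentiableAt ℝ (fun z => (g z)⁻¹ i j) y) (l i j : ι) :
    pd l (fun z => (g z)⁻¹ i j) y
      = -∑ m, (christoffel g y i l m * (g y)⁻¹ m j + christoffel g y j l m * (g y)⁻¹ i m) := by
  have h2 : g y * (g y)⁻¹ = 1 := mul_eq_one_comm.mp (h1 y hy)
  set dH : Matrix ι ι ℝ := Matrix.of fun a b => pd l (fun z => (g z)⁻¹ a b) y with hdH
  set dg : Matrix ι ι ℝ := Matrix.of fun a b => pd l (fun z => g z a b) y with hdg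
  set C : Matrix ι ι ℝ := Matrix.of fun a b => christoffel g y a l b with hC
  have e1 : dH * g y + (g y)⁻¹ * dg = 0 := by
    ext a b
    have h5 : pd l (fun z => ∑ m, (g z)⁻¹ a m * g z m b) y = 0 := by
      rw [← pd_const (y := y) l ((1 : Matrix ι ι ℝ) a b)]
      refine pd_congr_of_eqOn hU hy fun z hz => ?_
      rw [← h1 z hz, Matrix.mul_apply]
    rw [pd_sum (F := fun m z => (g z)⁻¹ a m * g z m b) _ _ (fun k _ => (hd' a k).mul (hd k b))] at h5
    simp only [Matrix.add_apply, Matrix.mul_apply, Matrix.zero_apply, ← Finset.sum_add_distrib]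
    rw [← h5]
    exact Finset.sum_congr rfl fun m _ => (pd_mul l (hd' a m) (hd m b)).symm
  have e2 : dg = (g y * C).transpose + g y * C := by
    ext a b
    simp only [hdg, Matrix.of_apply, pd_metric h2 hs, Matrix.add_apply, Matrix.transpose_apply,
      Matrix.mul_apply, Finset.sum_add_distrib, hC]
  have hgt : (g y).transpose = g y := by ext a b; exact hs y b a
  have e3 : dH = -(C * (g y)⁻¹ + (C * (g y)⁻¹).transpose) := by
    have : dH = -((g y)⁻¹ * dg * (g y)⁻¹) := by
      rw [eq_neg_iff_add_eq_zero]
      calc dH + (g y)⁻¹ * dg * (g y)⁻¹ = (dH * g y + (g y)⁻¹ * dg) * (g y)⁻¹ := by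
            rw [Matrix.add_mul, Matrix.mul_assoc dH, h2, Matrix.mul_one]
        _ = 0 := by rw [e1, Matrix.zero_mul]
    rw [this, e2, Matrix.transpose_mul, Matrix.transpose_mul, Matrix.transpose_nonsing_inv, hgt,
      Matrix.mul_add, Matrix.add_mul, ← Matrix.mul_assoc (g y)⁻¹ (g y), h1 y hy, Matrix.one_mul,
      Matrix.mul_assoc, Matrix.mul_assoc, h2, Matrix.mul_one, add_comm]
  have := congrFun (congrFun e3 i) j
  simp only [hdH, hC, Matrix.of_apply, Matrix.neg_apply, Matrix.add_apply, Matrix.mul_apply,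
    Matrix.transpose_apply] at this
  rw [this, Finset.sum_add_distrib]
  congr 2
  exact Finset.sum_congr rfl fun m _ => by rw [inv_symm hs m i]

end Metric

/-! ### The Kaluza-Klein family of metrics and its connection. -/

/-- The metric `exp(s) h + ε exp(-s) (dθ + A)²` on `W × ℝ`. -/
def kkMetric (ε : ℝ) (h : (Fin 3 → ℝ) → Matrix (Fin 3) (Fin 3) ℝ) (s : (Fin 3 → ℝ) → ℝ)
    (A : (Fin 3 → ℝ) → Fin 3 → ℝ) (y : Fin 3 → ℝ) : Matrix (Fin 3 ⊕ Unit) (Fin 3 ⊕ Unit) ℝ :=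
  Matrix.fromBlocks
    (Matrix.of fun i j => Real.exp (s y) * h y i j + ε * (Real.exp (-s y) * (A y i * A y j)))
    (Matrix.of fun i _ => ε * (Real.exp (-s y) * A y i))
    (Matrix.of fun _ j => ε * (Real.exp (-s y) * A y j))
    (Matrix.of fun _ _ => ε * Real.exp (-s y))

/-- The inverse of `kkMetric`. -/
def kkInverse (ε : ℝ) (h : (Fin 3 → ℝ) → Matrix (Fin 3) (Fin 3) ℝ) (s : (Fin 3 → ℝ) → ℝ)
    (A : (Fin 3 → ℝ) → Fin 3 → ℝ) (y : Fin 3 → ℝ) : Matrix (Fin 3 ⊕ Unit) (Fin 3 ⊕ Unit) ℝ :=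
  Matrix.fromBlocks
    (Matrix.of fun i j => Real.exp (-s y) * (h y)⁻¹ i j)
    (Matrix.of fun i _ => -(Real.exp (-s y) * ∑ l, (h y)⁻¹ i l * A y l))
    (Matrix.of fun _ j => -(Real.exp (-s y) * ∑ l, A y l * (h y)⁻¹ l j))
    (Matrix.of fun _ _ => ε * Real.exp (s y)
      + Real.exp (-s y) * ∑ i, ∑ j, A y i * (h y)⁻¹ i j * A y j)

/-- The gradient `sᵏ = hᵏˡ ∂ₗ s`. -/
def gradUp (h : (Fin 3 → ℝ) → Matrix (Fin 3) (Fin 3) ℝ) (s : (Fin 3 → ℝ) → ℝ) (y : Fin 3 → ℝ)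
    (k : Fin 3) : ℝ :=
  ∑ l, pd l s y * (h y)⁻¹ l k

/-- The mixed components `Fᵢᵏ = Fᵢₗ hˡᵏ` of `F = dA`. -/
def curlUp (h : (Fin 3 → ℝ) → Matrix (Fin 3) (Fin 3) ℝ) (A : (Fin 3 → ℝ) → Fin 3 → ℝ)
    (y : Fin 3 → ℝ) (i k : Fin 3) : ℝ :=
  ∑ l, curl A y i l * (h y)⁻¹ l k

/-- The coefficients of the Levi-Civita connection of `kkMetric` in the frame
`eᵢ = ∂ᵢ - Aᵢ ∂_θ`, `e_θ = ∂_θ`. -/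
def kkCoeff (ε : ℝ) (h : (Fin 3 → ℝ) → Matrix (Fin 3) (Fin 3) ℝ) (s : (Fin 3 → ℝ) → ℝ)
    (A : (Fin 3 → ℝ) → Fin 3 → ℝ) (y : Fin 3 → ℝ) (c a b : Fin 3 ⊕ Unit) : ℝ :=
  match c, a, b with
  | .inl k, .inl i, .inl j => christoffel h y k i j
      + 1 / 2 * (pd i s y * (if k = j then 1 else 0) + pd j s y * (if k = i then 1 else 0)
        - gradUp h s y k * h y i j)
  | .inl k, .inl i, .inr _ => ε / 2 * (Real.exp (-s y) ^ 2 * curlUp h A y i k)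
  | .inl k, .inr _, .inl i => ε / 2 * (Real.exp (-s y) ^ 2 * curlUp h A y i k)
  | .inl k, .inr _, .inr _ => ε / 2 * (Real.exp (-s y) ^ 2 * gradUp h s y k)
  | .inr _, .inl i, .inl j => -1 / 2 * curl A y i j
  | .inr _, .inl i, .inr _ => -1 / 2 * pd i s y
  | .inr _, .inr _, .inl i => -1 / 2 * pd i s y
  | .inr _, .inr _, .inr _ => 0

/-- Smooth data on a coordinate domain for a metric of the form `exp(s) h ± exp(-s) (dθ + A)²`. -/
structure IsKKData (U : Set (Fin 3 → ℝ)) (h : (Fin 3 → ℝ) → Matrix (Fin 3) (Fin 3) ℝ)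
    (s : (Fin 3 → ℝ) → ℝ) (A : (Fin 3 → ℝ) → Fin 3 → ℝ) : Prop where
  isOpen : IsOpen U
  metric : ∀ i j, ContDiffOn ℝ ∞ (fun y => h y i j) U
  symm : ∀ y i j, h y i j = h y j i
  det : ∀ y ∈ U, (h y).det ≠ 0
  scalar : ContDiffOn ℝ ∞ s U
  potential : ∀ i, ContDiffOn ℝ ∞ (fun y => A y i) U

lemma pd_exp {ι : Type*} [Fintype ι] [DecidableEq ι] {f : (ι → ℝ) → ℝ} {y : ι → ℝ} (i : ι)
    (hf : DifferentiableAt ℝ f y) :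
    pd i (fun z => Real.exp (f z)) y = Real.exp (f y) * pd i f y := by
  unfold pd
  rw [hf.hasFDerivAt.exp.fderiv]
  simp

namespace IsKKData

variable {ε : ℝ} {U : Set (Fin 3 → ℝ)} {h : (Fin 3 → ℝ) → Matrix (Fin 3) (Fin 3) ℝ}
  {s : (Fin 3 → ℝ) → ℝ} {A : (Fin 3 → ℝ) → Fin 3 → ℝ} {y : Fin 3 → ℝ}

section
variable (D : IsKKData U h s A) (hy : y ∈ U)
include D hy

lemma differentiableAt_of_contDiffOn {f : (Fin 3 → ℝ) → ℝ} (hf : ContDiffOn ℝ ∞ f U) :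
    DifferentiableAt ℝ f y :=
  (hf.contDiffAt (D.isOpen.mem_nhds hy)).differentiableAt (by simp)

lemma inv_mul : (h y)⁻¹ * h y = 1 := Matrix.nonsing_inv_mul _ (D.det y hy).isUnit

lemma mul_inv : h y * (h y)⁻¹ = 1 := Matrix.mul_nonsing_inv _ (D.det y hy).isUnit

lemma sum_inv_mul (i j : Fin 3) : ∑ m, (h y)⁻¹ i m * h y m j = if i = j then 1 else 0 := by
  rw [← Matrix.mul_apply, D.inv_mul hy, Matrix.one_apply]

lemma differentiableAt_metric (i j : Fin 3) : DifferentiableAt ℝ (fun z => h z i j) y :=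
  D.differentiableAt_of_contDiffOn hy (D.metric i j)

lemma differentiableAt_scalar : DifferentiableAt ℝ s y :=
  D.differentiableAt_of_contDiffOn hy D.scalar

lemma differentiableAt_potential (i : Fin 3) : DifferentiableAt ℝ (fun z => A z i) y :=
  D.differentiableAt_of_contDiffOn hy (D.potential i)

lemma differentiableAt_pd_scalar (i : Fin 3) : DifferentiableAt ℝ (pd i s) y :=
  D.differentiableAt_of_contDiffOn hy (contDiffOn_pd D.isOpen D.scalar i)

lemma differentiableAt_pd_potential (i j : Fin 3) :
    DifferentiableAt ℝ (pd i fun z => A z j) y :=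
  D.differentiableAt_of_contDiffOn hy (contDiffOn_pd D.isOpen (D.potential j) i)

lemma differentiableAt_inv (i j : Fin 3) : DifferentiableAt ℝ (fun z => (h z)⁻¹ i j) y :=
  D.differentiableAt_of_contDiffOn hy (contDiffOn_inv_apply D.metric D.det i j)

lemma differentiableAt_curl (i j : Fin 3) : DifferentiableAt ℝ (fun z => curl A z i j) y :=
  (D.differentiableAt_pd_potential hy i j).sub (D.differentiableAt_pd_potential hy j i)

lemma differentiableAt_gradUp (k : Fin 3) : DifferentiableAt ℝ (fun z => gradUp h s z k) y := by
  have h1 := D.differentiableAt_pd_scalar hy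
  have h2 := D.differentiableAt_inv hy
  exact DifferentiableAt.fun_sum fun l _ => (h1 l).mul (h2 l k)

lemma differentiableAt_curlUp (i k : Fin 3) :
    DifferentiableAt ℝ (fun z => curlUp h A z i k) y := by
  have h1 := D.differentiableAt_curl hy
  have h2 := D.differentiableAt_inv hy
  exact DifferentiableAt.fun_sum fun l _ => (h1 i l).mul (h2 l k)

lemma differentiableAt_christoffel (k i j : Fin 3) :
    DifferentiableAt ℝ (fun z => christoffel h z k i j) y := by
  have h1 := D.differentiableAt_inv hy
  have h2 : ∀ a b c, DifferentiableAt ℝ (pd a fun z => h z b c) y := fun a b c =>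
    D.differentiableAt_of_contDiffOn hy (contDiffOn_pd D.isOpen (D.metric b c) a)
  exact (DifferentiableAt.fun_sum fun l _ => (h1 k l).mul
    (((h2 i j l).add (h2 j i l)).sub (h2 l i j))).const_mul (1 / 2)

lemma differentiableAt_kkCoeff (c a b : Fin 3 ⊕ Unit) :
    DifferentiableAt ℝ (fun z => kkCoeff ε h s A z c a b) y := by
  have h1 := D.differentiableAt_christoffel hy
  have h2 := D.differentiableAt_curlUp hy
  have h3 := D.differentiableAt_gradUp hy
  have h4 := D.differentiableAt_curl hy
  have h5 := D.differentiableAt_pd_scalar hy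
  have h6 := D.differentiableAt_scalar hy
  have h7 := D.differentiableAt_metric hy
  rcases c with c | c <;> rcases a with a | a <;> rcases b with b | b <;>
    simp only [kkCoeff] <;> fun_prop

lemma sum_gradUp_mul (i : Fin 3) : ∑ k, gradUp h s y k * h y k i = pd i s y := by
  have h1 : Matrix.vecMul (Matrix.vecMul (fun l => pd l s y) (h y)⁻¹) (h y) = fun l => pd l s y := by
    rw [Matrix.vecMul_vecMul, D.inv_mul hy, Matrix.vecMul_one]
  exact congrFun h1 i

lemma sum_curlUp_mul (i j : Fin 3) : ∑ k, curlUp h A y i k * h y k j = curl A y i j := by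
  have h1 : Matrix.vecMul (Matrix.vecMul (curl A y i) (h y)⁻¹) (h y) = curl A y i := by
    rw [Matrix.vecMul_vecMul, D.inv_mul hy, Matrix.vecMul_one]
  exact congrFun h1 j

omit hy in
lemma inverse_symm (i j : Fin 3) : (h y)⁻¹ i j = (h y)⁻¹ j i := inv_symm D.symm i j

lemma kkInverse_mul_kkMetric (hε : ε * ε = 1) : kkInverse ε h s A y * kkMetric ε h s A y = 1 := by
  have hE : Real.exp (-s y) * Real.exp (s y) = 1 := by rw [← Real.exp_add]; simp
  have hH := D.sum_inv_mul hy
  simp only [Fin.sum_univ_three] at hH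
  ext a b
  rcases a with i | ⟨⟩ <;> rcases b with j | ⟨⟩ <;>
    simp only [Matrix.mul_apply, Fintype.sum_sum_type, Finset.univ_unique, Finset.sum_singleton,
      kkInverse, kkMetric, Matrix.fromBlocks_apply₁₁, Matrix.fromBlocks_apply₁₂,
      Matrix.fromBlocks_apply₂₁, Matrix.fromBlocks_apply₂₂, Matrix.of_apply, Fin.sum_univ_three,
      Matrix.one_apply, Sum.inl.injEq, reduceCtorEq, if_false, if_true]
  · linear_combination hH i j + ((h y)⁻¹ i 0 * h y 0 j + (h y)⁻¹ i 1 * h y 1 j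
      + (h y)⁻¹ i 2 * h y 2 j) * hE
  · ring
  · fin_cases j <;>
    [have h1 := hH 0 0; have h1 := hH 0 1; have h1 := hH 0 2] <;>
    [have h2 := hH 1 0; have h2 := hH 1 1; have h2 := hH 1 2] <;>
    [have h3 := hH 2 0; have h3 := hH 2 1; have h3 := hH 2 2] <;>
    simp at h1 h2 h3 ⊢
    · linear_combination -Real.exp (-s y) * Real.exp (s y) * (A y 0 * h1 + A y 1 * h2 + A y 2 * h3)
        + Real.exp (-s y) * Real.exp (s y) * A y 0 * hε
    · linear_combination -Real.exp (-s y) * Real.exp (s y) * (A y 0 * h1 + A y 1 * h2 + A y 2 * h3)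
        + Real.exp (-s y) * Real.exp (s y) * A y 1 * hε
    · linear_combination -Real.exp (-s y) * Real.exp (s y) * (A y 0 * h1 + A y 1 * h2 + A y 2 * h3)
        + Real.exp (-s y) * Real.exp (s y) * A y 2 * hε
  · linear_combination hE + Real.exp (-s y) * Real.exp (s y) * hε

lemma kkMetric_inv (hε : ε * ε = 1) : (kkMetric ε h s A y)⁻¹ = kkInverse ε h s A y :=
  Matrix.inv_eq_left_inv (D.kkInverse_mul_kkMetric hy hε)

lemma pd_kkMetric (l : Fin 3) (a b : Fin 3 ⊕ Unit) : 
    pd l (fun z => kkMetric ε h s A z a b) y = match a, b with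
    | .inl i, .inl j => Real.exp (s y) * (pd l s y * h y i j + pd l (fun z => h z i j) y)
        + ε * (Real.exp (-s y) * (pd l (fun z => A z i) y * A y j + A y i * pd l (fun z => A z j) y
          - pd l s y * A y i * A y j))
    | .inl i, .inr _ => ε * (Real.exp (-s y) * (pd l (fun z => A z i) y - pd l s y * A y i))
    | .inr _, .inl i => ε * (Real.exp (-s y) * (pd l (fun z => A z i) y - pd l s y * A y i))
    | .inr _, .inr _ => -(ε * (Real.exp (-s y) * pd l s y)) := by
  have h1 := D.differentiableAt_scalar hy
  have h2 := D.differentiableAt_metric hy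
  have h3 := D.differentiableAt_potential hy
  rcases a with i | a <;> rcases b with j | b <;>
    simp only [kkMetric, Matrix.fromBlocks_apply₁₁, Matrix.fromBlocks_apply₁₂,
      Matrix.fromBlocks_apply₂₁, Matrix.fromBlocks_apply₂₂, Matrix.of_apply] <;>
    simp (disch := fun_prop) only [pd_add, pd_mul, pd_const, pd_exp, pd_neg] <;> ring

lemma differentiableAt_kkMetric (a b : Fin 3 ⊕ Unit) :
    DifferentiableAt ℝ (fun z => kkMetric ε h s A z a b) y := by
  have h1 := D.differentiableAt_scalar hy
  have h2 := D.differentiableAt_metric hy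
  have h3 := D.differentiableAt_potential hy
  rcases a with i | a <;> rcases b with j | b <;>
    simp only [kkMetric, Matrix.fromBlocks_apply₁₁, Matrix.fromBlocks_apply₁₂,
      Matrix.fromBlocks_apply₂₁, Matrix.fromBlocks_apply₂₂, Matrix.of_apply] <;> fun_prop

/-- The right side is the Koszul expression of `exp(s) h`, divided by `exp(s)`: horizontally the
connection is that of the conformally rescaled base. -/
lemma sum_mul_kkCoeff (l i j : Fin 3) :
    ∑ k, h y l k * kkCoeff ε h s A y (.inl k) (.inl i) (.inl j)
      = 1 / 2 * (pd i (fun z => h z j l) y + pd j (fun z => h z i l) y - pd l (fun z => h z i j) y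
        + pd i s y * h y l j + pd j s y * h y l i - pd l s y * h y i j) := by
  have h1 := sum_mul_christoffel (D.mul_inv hy) l i j
  have h2 := D.sum_gradUp_mul hy l
  simp only [Fin.sum_univ_three, kkCoeff] at h1 h2 ⊢
  have h3 : ∀ i, h y l 0 * (if (0 : Fin 3) = i then 1 else 0)
      + h y l 1 * (if (1 : Fin 3) = i then 1 else 0)
      + h y l 2 * (if (2 : Fin 3) = i then 1 else 0) = h y l i := by
    intro i; fin_cases i <;> simp
  simp only [D.symm y _ l] at h2
  linear_combination h1 - 1 / 2 * h y i j * h2 + 1 / 2 * pd i s y * h3 j + 1 / 2 * pd j s y * h3 i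

lemma sum_mul_kkCoeff_fibre (l i : Fin 3) :
    ∑ k, h y l k * kkCoeff ε h s A y (.inl k) (.inl i) (.inr ())
      = ε / 2 * (Real.exp (-s y) ^ 2 * curl A y i l) := by
  rw [← D.sum_curlUp_mul hy i l]
  simp only [kkCoeff, Finset.mul_sum]
  exact Finset.sum_congr rfl fun k _ => by rw [D.symm y l k]; ring

lemma sum_mul_kkCoeff_fibre_fibre (l : Fin 3) :
    ∑ k, h y l k * kkCoeff ε h s A y (.inl k) (.inr ()) (.inr ())
      = ε / 2 * (Real.exp (-s y) ^ 2 * pd l s y) := by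
  rw [← D.sum_gradUp_mul hy l]
  simp only [kkCoeff, Finset.mul_sum]
  exact Finset.sum_congr rfl fun k _ => by rw [D.symm y l k]; ring

/-- The Koszul formula with lowered index, in the coordinate frame. By `christoffel_eq_of_lower` it
certifies that `kkCoeff`, carried to coordinates by `frameConn`, is the Levi-Civita connection. -/
lemma kkMetric_lower (l a b : Fin 3 ⊕ Unit) :
    basePd a (fun z => kkMetric ε h s A z b l) y + basePd b (fun z => kkMetric ε h s A z a l) y
        - basePd l (fun z => kkMetric ε h s A z a b) y
      = 2 * ∑ m, kkMetric ε h s A y l m * frameConn (kkCoeff ε h s A) A y m a b := by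
  have hE : Real.exp (s y) * Real.exp (-s y) = 1 := by rw [← Real.exp_add]; simp
  have h1 := D.sum_mul_kkCoeff (ε := ε) hy
  have h2 := D.sum_mul_kkCoeff_fibre (ε := ε) hy
  have h3 := D.sum_mul_kkCoeff_fibre_fibre (ε := ε) hy
  have h4 : ∀ k i, kkCoeff ε h s A y (.inl k) (.inr ()) (.inl i)
    = kkCoeff ε h s A y (.inl k) (.inl i) (.inr ()) := fun _ _ => rfl
  have h5 : ∀ i j, kkCoeff ε h s A y (.inr ()) (.inl i) (.inl j) = -1 / 2 * curl A y i j :=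
    fun _ _ => rfl
  have h6 : ∀ i, kkCoeff ε h s A y (.inr ()) (.inl i) (.inr ()) = -1 / 2 * pd i s y := fun _ => rfl
  have h7 : ∀ i, kkCoeff ε h s A y (.inr ()) (.inr ()) (.inl i) = -1 / 2 * pd i s y := fun _ => rfl
  have h8 : kkCoeff ε h s A y (.inr ()) (.inr ()) (.inr ()) = 0 := rfl
  simp only [Fin.sum_univ_three, curl] at h1 h2 h3
  rcases l with l | ⟨⟩ <;> rcases a with i | ⟨⟩ <;> rcases b with j | ⟨⟩ <;>
    simp only [basePd, D.pd_kkMetric hy, Fintype.sum_sum_type, Finset.univ_unique,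
      Finset.sum_singleton, PUnit.default_eq_unit, Fin.sum_univ_three, frameConn, frameSum,
      extCov_inl, extCov_inr, pd_const, h4, h5, h6, h7, h8]
  all_goals
    simp only [kkMetric, Matrix.fromBlocks_apply₁₁, Matrix.fromBlocks_apply₁₂,
      Matrix.fromBlocks_apply₂₁, Matrix.fromBlocks_apply₂₂, Matrix.of_apply, curl]
  -- The weights in A expand `∂ₐ = eₐ + Aₐ e_θ`; `hE` reduces `e^s e^{-2s}`, produced by lowering
  -- with `e^s h`, to `e^{-s}`.
  · linear_combination -2 * Real.exp (s y) * (h1 l i j + A y j * h2 l i + A y i * h2 l j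
        + A y i * A y j * h3 l)
      - ε * Real.exp (-s y) * (A y j * (pd i (fun z => A z l) y - pd l (fun z => A z i) y)
        + A y i * (pd j (fun z => A z l) y - pd l (fun z => A z j) y)
        + A y i * A y j * pd l s y) * hE
      + Real.exp (s y) * (pd i s y * D.symm y j l + pd j s y * D.symm y i l)
  · linear_combination -2 * Real.exp (s y) * (h2 l i + A y i * h3 l)
      - ε * Real.exp (-s y) * (pd i (fun z => A z l) y - pd l (fun z => A z i) y
        + A y i * pd l s y) * hE
  · linear_combination -2 * Real.exp (s y) * (h2 l j + A y j * h3 l)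
      - ε * Real.exp (-s y) * (pd j (fun z => A z l) y - pd l (fun z => A z j) y
        + A y j * pd l s y) * hE
  · linear_combination -2 * Real.exp (s y) * h3 l - ε * Real.exp (-s y) * pd l s y * hE
  all_goals ring

omit hy in
lemma christoffel_kkMetric (hε : ε * ε = 1) {q : Fin 3 ⊕ Unit → ℝ} (hq : baseCoord q ∈ U) :
    christoffel (fun p => kkMetric ε h s A (baseCoord p)) q
      = frameConn (kkCoeff ε h s A) A (baseCoord q) := by
  have h1 : ∀ l a b, pd l (fun p => kkMetric ε h s A (baseCoord p) a b) q
      = basePd l (fun z => kkMetric ε h s A z a b) (baseCoord q) := fun l a b =>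
    pd_baseCoord l (D.differentiableAt_kkMetric hq a b)
  ext c a b
  refine christoffel_eq_of_lower
    (X := fun m => frameConn (kkCoeff ε h s A) A (baseCoord q) m a b) ?_ (fun l => ?_) c
  · rw [D.kkMetric_inv hq hε, D.kkInverse_mul_kkMetric hq hε]
  · rw [h1, h1, h1, D.kkMetric_lower hq]

omit hy in
lemma ricci_kkMetric (hε : ε * ε = 1) {q : Fin 3 ⊕ Unit → ℝ} (hq : baseCoord q ∈ U)
    (j k : Fin 3 ⊕ Unit) :
    ricci (christoffel fun p => kkMetric ε h s A (baseCoord p)) q j k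
      = frameRicci (kkCoeff ε h s A) A (baseCoord q) j k
        + extCov (A (baseCoord q)) k * frameRicci (kkCoeff ε h s A) A (baseCoord q) j (.inr ())
        + extCov (A (baseCoord q)) j * frameRicci (kkCoeff ε h s A) A (baseCoord q) (.inr ()) k
        + extCov (A (baseCoord q)) j * extCov (A (baseCoord q)) k
          * frameRicci (kkCoeff ε h s A) A (baseCoord q) (.inr ()) (.inr ()) := by
  have h1 := fun c a b => D.differentiableAt_kkCoeff (ε := ε) hq c a b
  have h2 := fun i => D.differentiableAt_potential hq i
  rw [ricci_eq_baseRicci D.isOpen (fun p hp => D.christoffel_kkMetric hε hp) hq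
    (differentiableAt_frameConn h1 h2 fun i j => D.differentiableAt_pd_potential hq i j),
    baseRicci_frameConn h1 h2]

end

end IsKKData

/-! ### The Ricci tensor of the family. -/

/-- The algebra behind the Ricci tensor of a conformally related connection, with a correction
from the fibre. -/
lemma conformal_ricci_algebra {γ : Fin 3 → Fin 3 → Fin 3 → ℝ} {S s : Fin 3 → ℝ}
    {dS ds h : Fin 3 → Fin 3 → ℝ} {dh : Fin 3 → Fin 3 → Fin 3 → ℝ}
    (hγ : ∀ k i j, γ k i j = γ k j i) (hh : ∀ i j, h i j = h j i)
    (hS : ∀ i, ∑ k, S k * h k i = s i)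
    (hdS : ∀ l i, ∑ k, (dS l k * h k i + S k * dh l k i) = ds l i) (hds : ∀ i j, ds i j = ds j i)
    (hdh : ∀ l i j, dh l i j = ∑ m, (h j m * γ m l i + h i m * γ m l j))
    {B : Fin 3 → Fin 3 → Fin 3 → ℝ}
    (hB : ∀ k i j, B k i j = 1 / 2 * (s i * (if k = j then 1 else 0)
      + s j * (if k = i then 1 else 0) - S k * h i j))
    {dB : Fin 3 → Fin 3 → Fin 3 → Fin 3 → ℝ}
    (hdB : ∀ l k i j, dB l k i j = 1 / 2 * (ds l i * (if k = j then 1 else 0)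
      + ds l j * (if k = i then 1 else 0) - (dS l k * h i j + S k * dh l i j)))
    (j k : Fin 3) :
    ∑ i, (dB i i j k - dB j i i k + ∑ p, (γ i i p * B p j k + B i i p * γ p j k + B i i p * B p j k
        - γ i j p * B p i k - B i j p * γ p i k - B i j p * B p i k))
      + 1 / 2 * ds j k - 1 / 2 * ∑ p, s p * (γ p j k + B p j k) - 1 / 4 * (s j * s k)
    = -1 / 2 * h j k * ∑ i, (dS i i + ∑ p, γ i i p * S p) - 1 / 2 * (s j * s k) := by
  -- Here `B` is the difference between the connections of `exp(s) h` and `h`. In dimension three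
  -- the conformal change contributes `-(1/2) ∇ⱼ∇ₖs`, and the fibre, of length `e^{-s/2}`,
  -- contributes `(1/2) ∇'ⱼ∇'ₖs` for the rescaled connection. The Hessians and the `|ds|²` terms
  -- cancel. The two facts below exchange derivatives of the raised gradient for second derivatives
  -- of s, and use the symmetry of the latter.
  have e1 := hdS j k
  have e2 := hds j k
  simp only [← hS, hB, hdB, hdh, Fin.sum_univ_three] at e1 ⊢
  fin_cases j <;> fin_cases k <;>
    simp only [Fin.zero_eta, Fin.mk_one, Fin.reduceFinMk, Fin.isValue, Fin.reduceEq, if_true,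
      if_false, mul_one, mul_zero, zero_ne_one, one_ne_zero] at e1 e2 ⊢ <;>
    simp only [hγ _ 1 0, hγ _ 2 0, hγ _ 2 1, hh 1 0, hh 2 0, hh 2 1] at e1 ⊢ <;>
    linear_combination 1 / 2 * e1 - 1 / 2 * e2

section Coefficients

variable (ε : ℝ) (h : (Fin 3 → ℝ) → Matrix (Fin 3) (Fin 3) ℝ) (s : (Fin 3 → ℝ) → ℝ)
  (A : (Fin 3 → ℝ) → Fin 3 → ℝ) (y : Fin 3 → ℝ) (i j k : Fin 3) (u v w : Unit)

lemma kkCoeff_inl_inr_inr : kkCoeff ε h s A y (.inl k) (.inr u) (.inr v)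
    = ε / 2 * (Real.exp (-s y) ^ 2 * gradUp h s y k) := rfl

lemma kkCoeff_inl_inr_inl : kkCoeff ε h s A y (.inl k) (.inr u) (.inl i)
    = ε / 2 * (Real.exp (-s y) ^ 2 * curlUp h A y i k) := rfl

lemma kkCoeff_inl_inl_inr : kkCoeff ε h s A y (.inl k) (.inl i) (.inr u)
    = ε / 2 * (Real.exp (-s y) ^ 2 * curlUp h A y i k) := rfl

lemma kkCoeff_inr_inl_inl : kkCoeff ε h s A y (.inr u) (.inl i) (.inl j)
    = -1 / 2 * curl A y i j := rfl

lemma kkCoeff_inr_inl_inr : kkCoeff ε h s A y (.inr u) (.inl i) (.inr v) = -1 / 2 * pd i s y := rfl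

lemma kkCoeff_inr_inr_inl : kkCoeff ε h s A y (.inr u) (.inr v) (.inl i) = -1 / 2 * pd i s y := rfl

lemma kkCoeff_inr_inr_inr : kkCoeff ε h s A y (.inr u) (.inr v) (.inr w) = 0 := rfl

end Coefficients

lemma curl_antisymm (A : (Fin 3 → ℝ) → Fin 3 → ℝ) (y : Fin 3 → ℝ) (i j : Fin 3) :
    curl A y i j = -curl A y j i := by
  unfold curl; ring

namespace IsKKData
variable {ε : ℝ} {U : Set (Fin 3 → ℝ)} {h : (Fin 3 → ℝ) → Matrix (Fin 3) (Fin 3) ℝ}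
  {s : (Fin 3 → ℝ) → ℝ} {A : (Fin 3 → ℝ) → Fin 3 → ℝ} {y : Fin 3 → ℝ}
  (D : IsKKData U h s A) (hy : y ∈ U)
include D hy

lemma pd_inverse (l i j : Fin 3) :
    pd l (fun z => (h z)⁻¹ i j) y
      = -∑ m, (christoffel h y i l m * (h y)⁻¹ m j + christoffel h y j l m * (h y)⁻¹ i m) :=
  pd_inv_metric D.isOpen hy (fun _ hz => D.inv_mul hz) D.symm (D.differentiableAt_metric hy)
    (D.differentiableAt_inv hy) l i j

/-- Raising the index commutes with the covariant derivative; `pd_inverse` supplies this in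
coordinates. -/
lemma divergence_gradUp :
    ∑ i, (pd i (fun z => gradUp h s z i) y + ∑ k, christoffel h y i i k * gradUp h s y k)
      = box h s y := by
  have h1 := D.differentiableAt_pd_scalar hy
  have h2 := D.differentiableAt_inv hy
  have h3 : ∀ i, pd i (fun z => gradUp h s z i) y
      = ∑ l, (pd i (pd l s) y * (h y)⁻¹ l i + pd l s y * pd i (fun z => (h z)⁻¹ l i) y) := by
    intro i
    unfold gradUp
    rw [pd_sum _ _ fun l _ => (h1 l).fun_mul (h2 l i)]
    exact Finset.sum_congr rfl fun l _ => pd_mul i (h1 l) (h2 l i)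
  have hs := D.inverse_symm (y := y)
  simp only [h3, D.pd_inverse hy]
  simp only [box, gradUp, Fin.sum_univ_three, hs 1 0, hs 2 0, hs 2 1]
  ring

lemma pd_exp_mul {f : (Fin 3 → ℝ) → ℝ} (hf : DifferentiableAt ℝ f y) (l : Fin 3) :
    pd l (fun z => ε / 2 * (Real.exp (-s z) ^ 2 * f z)) y
      = ε / 2 * (Real.exp (-s y) ^ 2 * (pd l f y - 2 * pd l s y * f y)) := by
  have h1 := D.differentiableAt_scalar hy
  simp only [pow_two]
  simp (disch := fun_prop) only [pd_mul, pd_const, pd_exp, pd_neg]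
  ring

/-- A trace of Christoffel symbols is the derivative of the logarithm of the volume density, and
that of `exp(s) h` is `e^{3s/2} √|det h|`. -/
lemma sum_kkCoeff_trace (k : Fin 3) :
    ∑ i, kkCoeff ε h s A y (.inl i) (.inl i) (.inl k)
      = ∑ i, christoffel h y i i k + 3 / 2 * pd k s y := by
  have h1 := D.sum_gradUp_mul hy k
  simp only [Fin.sum_univ_three] at h1
  simp only [kkCoeff, Fin.sum_univ_three]
  fin_cases k <;> simp at h1 ⊢ <;> linear_combination -1 / 2 * h1

/-- The divergence of the fibre acceleration gives `□s`; products of mixed coefficients give the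
term quadratic in F, with `ε² = 1`. -/
lemma frameRicci_inr_inr (hε : ε * ε = 1) :
    frameRicci (kkCoeff ε h s A) A y (.inr ()) (.inr ())
      = ε / 2 * Real.exp (-s y) ^ 2 * box h s y
        - 1 / 4 * Real.exp (-s y) ^ 4 * ∑ i, ∑ k, curlUp h A y i k * curlUp h A y k i := by
  have h1 := D.sum_kkCoeff_trace (ε := ε) (A := A) hy
  have h2 := fun k l => D.pd_exp_mul (ε := ε) hy (D.differentiableAt_gradUp hy k) l
  have h3 := D.divergence_gradUp hy
  simp only [Fin.sum_univ_three] at h1 h3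
  simp only [frameRicci, baseRicci, Fintype.sum_sum_type, Finset.univ_unique,
    Finset.sum_singleton, PUnit.default_eq_unit, basePd, Fin.sum_univ_three, ← h3]
  simp only [kkCoeff_inl_inr_inr, kkCoeff_inl_inr_inl, kkCoeff_inl_inl_inr, kkCoeff_inr_inl_inr,
    kkCoeff_inr_inr_inl, kkCoeff_inr_inr_inr, h2]
  linear_combination ε / 2 * Real.exp (-s y) ^ 2 * (gradUp h s y 0 * h1 0 + gradUp h s y 1 * h1 1
      + gradUp h s y 2 * h1 2)
    - 1 / 4 * Real.exp (-s y) ^ 4 * (curlUp h A y 0 0 ^ 2 + curlUp h A y 1 1 ^ 2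
      + curlUp h A y 2 2 ^ 2 + 2 * curlUp h A y 0 1 * curlUp h A y 1 0
      + 2 * curlUp h A y 0 2 * curlUp h A y 2 0 + 2 * curlUp h A y 1 2 * curlUp h A y 2 1) * hε

lemma sum_curlUp_trace : ∑ i, curlUp h A y i i = 0 := by
  have h1 := D.inverse_symm (y := y)
  have h2 := curl_antisymm A y
  have h3 : ∀ i, curl A y i i = 0 := fun i => by linarith [h2 i i]
  simp only [curlUp, Fin.sum_univ_three, h1 1 0, h1 2 0, h1 2 1, h2 1 0, h2 2 0, h2 2 1, h3]
  ring

/-- The two sides arise from opposite places of the conformal correction and cancel in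
`frameRicci_inl_inr`. -/
lemma sum_pd_mul_curlUp (j : Fin 3) :
    ∑ i, pd i s y * curlUp h A y j i = ∑ i, curl A y j i * gradUp h s y i := by
  have h1 := D.inverse_symm (y := y)
  simp only [curlUp, gradUp, Fin.sum_univ_three, h1 1 0, h1 2 0, h1 2 1]
  ring

omit D hy in
lemma sum_kkCoeff_mul (j : Fin 3) (X : Fin 3 → Fin 3 → ℝ) :
    ∑ i, ∑ p, kkCoeff ε h s A y (.inl i) (.inl j) (.inl p) * X i p
      = ∑ i, ∑ p, christoffel h y i j p * X i p
        + 1 / 2 * (pd j s y * ∑ i, X i i + ∑ p, pd p s y * X j p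
          - ∑ i, gradUp h s y i * ∑ p, X i p * h y j p) := by
  simp only [kkCoeff, Fin.sum_univ_three]
  fin_cases j <;> simp <;> ring

lemma frameRicci_inl_inr (j : Fin 3) :
    frameRicci (kkCoeff ε h s A) A y (.inl j) (.inr ())
      = ε / 2 * Real.exp (-s y) ^ 2 * ∑ i, (pd i (fun z => curlUp h A z j i) y
        - 2 * pd i s y * curlUp h A y j i + ∑ p, (christoffel h y i i p * curlUp h A y j p
        - christoffel h y i j p * curlUp h A y i p)) := by
  have h0 := D.sum_pd_mul_curlUp (A := A) hy j
  have h1 := D.sum_kkCoeff_trace (ε := ε) (A := A) hy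
  have h2 := fun j k l => D.pd_exp_mul (ε := ε) hy (D.differentiableAt_curlUp hy j k) l
  -- The trace `Fᵢⁱ` vanishes on all of `U`, hence so does its derivative; this removes the term `∂ⱼ
  -- Γⁱᵢθ`.
  have h3 : ∑ i, pd j (fun z => curlUp h A z i i) y = 0 := by
    rw [← pd_sum j _ fun i _ => D.differentiableAt_curlUp hy i i, ← pd_const (y := y) j 0]
    exact pd_congr_of_eqOn D.isOpen hy fun z hz => D.sum_curlUp_trace hz
  have h4 := D.sum_curlUp_trace (A := A) hy
  have h5 := fun i => D.sum_curlUp_mul (A := A) hy i j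
  have h6 := sum_kkCoeff_mul (ε := ε) (h := h) (s := s) (A := A) (y := y) j
    fun i p => curlUp h A y i p
  simp only [D.symm y _ j] at h5
  simp only [h5] at h6
  simp only [Fin.sum_univ_three] at h0 h1 h3 h4 h6
  simp only [frameRicci, baseRicci, Fintype.sum_sum_type, Finset.univ_unique,
    Finset.sum_singleton, PUnit.default_eq_unit, basePd, Fin.sum_univ_three]
  simp only [kkCoeff_inl_inr_inr, kkCoeff_inl_inl_inr, kkCoeff_inr_inl_inr, kkCoeff_inr_inr_inl,
    kkCoeff_inr_inr_inr, kkCoeff_inr_inl_inl, h2, pd_const]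
  simp only [curl_antisymm A y _ j] at h6 ⊢
  linear_combination ε / 2 * Real.exp (-s y) ^ 2 * (curlUp h A y j 0 * h1 0
    + curlUp h A y j 1 * h1 1 + curlUp h A y j 2 * h1 2 - h3 - h6 + h4 * pd j s y + h0)

lemma sum_curl_mul_curlUp_comm (j k : Fin 3) :
    ∑ p, curl A y j p * curlUp h A y k p = ∑ p, curl A y k p * curlUp h A y j p := by
  have h1 := D.inverse_symm (y := y)
  simp only [curlUp, Fin.sum_univ_three, h1 1 0, h1 2 0, h1 2 1]
  ring

lemma pd_kkCoeff_inl (l k i j : Fin 3) :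
    pd l (fun z => kkCoeff ε h s A z (.inl k) (.inl i) (.inl j)) y
      = pd l (fun z => christoffel h z k i j) y
        + 1 / 2 * (pd l (pd i s) y * (if k = j then 1 else 0)
          + pd l (pd j s) y * (if k = i then 1 else 0)
          - (pd l (fun z => gradUp h s z k) y * h y i j
            + gradUp h s y k * pd l (fun z => h z i j) y)) := by
  have h1 := D.differentiableAt_christoffel hy
  have h3 := D.differentiableAt_gradUp hy
  have h5 := D.differentiableAt_pd_scalar hy
  have h7 := D.differentiableAt_metric hy
  simp only [kkCoeff]
  simp (disch := fun_prop) only [pd_add, pd_mul, pd_const, pd_sub]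
  ring

lemma frameRicci_inl_inl (j k : Fin 3) :
    frameRicci (kkCoeff ε h s A) A y (.inl j) (.inl k)
      = ricci (christoffel h) y j k - 1 / 2 * h y j k * box h s y - 1 / 2 * (pd j s y * pd k s y)
        - ε / 2 * Real.exp (-s y) ^ 2 * ∑ p, curl A y j p * curlUp h A y k p := by
  have hdS : ∀ l i, ∑ k, (pd l (fun z => gradUp h s z k) y * h y k i
      + gradUp h s y k * pd l (fun z => h z k i) y) = pd l (pd i s) y := by
    intro l i
    have h1 : pd l (fun z => ∑ k, gradUp h s z k * h z k i) y = pd l (pd i s) y :=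
      pd_congr_of_eqOn D.isOpen hy fun z hz => D.sum_gradUp_mul hz i
    rw [← h1, pd_sum _ _ fun k _ =>
      (D.differentiableAt_gradUp hy k).fun_mul (D.differentiableAt_metric hy k i)]
    exact Finset.sum_congr rfl fun k _ =>
      (pd_mul l (D.differentiableAt_gradUp hy k) (D.differentiableAt_metric hy k i)).symm
  -- Unification through the two `rfl` arguments takes `B` to be the conformal correction in
  -- `kkCoeff` and `dB` its derivative as in `pd_kkCoeff_inl`. What is left over is quadratic in F.
  have key := conformal_ricci_algebra (fun k i j => christoffel_symm (g := h) (y := y) D.symm k i j)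
    (D.symm y) (D.sum_gradUp_mul hy) hdS
    (fun i j => pd_comm i j (D.scalar.contDiffAt (D.isOpen.mem_nhds hy)))
    (fun l i j => pd_metric (D.mul_inv hy) D.symm l i j)
    (fun _ _ _ => rfl) (fun _ _ _ _ => rfl) j k
  rw [D.divergence_gradUp hy] at key
  have h2 := D.differentiableAt_pd_scalar hy k
  have h4 := D.sum_curlUp_trace (A := A) hy
  have h5 := D.sum_curl_mul_curlUp_comm (A := A) hy j k
  simp only [Fin.sum_univ_three] at h4 h5 key
  simp only [frameRicci, baseRicci, Fintype.sum_sum_type, Finset.univ_unique, Finset.sum_singleton,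
    PUnit.default_eq_unit, basePd, D.pd_kkCoeff_inl hy, Fin.sum_univ_three]
  simp only [kkCoeff_inl_inr_inl, kkCoeff_inl_inl_inr, kkCoeff_inr_inl_inr, kkCoeff_inr_inr_inl,
    kkCoeff_inr_inr_inr, kkCoeff_inr_inl_inl, pd_const_mul j _ h2]
  simp only [curl_antisymm A y 0 j, curl_antisymm A y 1 j, curl_antisymm A y 2 j,
    curl_antisymm A y 0 k, curl_antisymm A y 1 k, curl_antisymm A y 2 k]
  simp only [kkCoeff, ricci, Fin.sum_univ_three]
  linear_combination key - ε / 4 * Real.exp (-s y) ^ 2 * (h4 * curl A y j k - h5)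

end IsKKData

/-! ### Trace reversal of the Einstein equation. -/

section Trace

variable {ι : Type*} [Fintype ι] [DecidableEq ι] {G F : (ι → ℝ) → Matrix ι ι ℝ} {Φ : (ι → ℝ) → ℝ}
  {y : ι → ℝ}

lemma sum_inv_mul_sqTensor :
    ∑ a, ∑ b, (G y)⁻¹ a b * sqTensor G F y a b = formSq G F y := by
  simp only [formSq, sqTensor, raise, Finset.mul_sum]
  refine Finset.sum_congr rfl fun a _ => ?_
  rw [Finset.sum_comm]
  exact Finset.sum_congr rfl fun c _ => Finset.sum_congr rfl fun b _ =>
    Finset.sum_congr rfl fun d _ => by ring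

/-- The Einstein equation in four dimensions follows from its trace-reversed form. -/
lemma einstein_of_traceReversed (hcard : Fintype.card ι = 4) (h1 : (G y)⁻¹ * G y = 1)
    (hs : ∀ a b, G y a b = G y b a) (c : ℝ)
    (hR : ∀ a b, ricci (christoffel G) y a b = 2 * (pd a Φ y * pd b Φ y)
      - c * (sqTensor G F y a b - 1 / 4 * formSq G F y * G y a b)) (a b : ι) :
    ricci (christoffel G) y a b - 1 / 2 * scalarCurv G y * G y a b
      = 2 * (pd a Φ y * pd b Φ y - 1 / 2 * gradSq G Φ y * G y a b)
        - c * (sqTensor G F y a b - 1 / 4 * formSq G F y * G y a b) := by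
  have h2 : ∑ a, ∑ b, (G y)⁻¹ a b * G y a b = 4 := by
    have : ∀ a, ∑ b, (G y)⁻¹ a b * G y a b = 1 := fun a => by
      rw [← Matrix.one_apply_eq (α := ℝ) a, ← h1, Matrix.mul_apply]
      exact Finset.sum_congr rfl fun b _ => by rw [hs a b]
    simp [this, hcard]
  -- The Maxwell stress tensor is trace-free because `Gᵃᵇ G_ab = 4`, so only the dilaton contributes
  -- to the scalar curvature.
  have h3 : scalarCurv G y = 2 * gradSq G Φ y := by
    have h4 : scalarCurv G y = 2 * gradSq G Φ y - c * ((∑ a, ∑ b, (G y)⁻¹ a b * sqTensor G F y a b)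
        - 1 / 4 * formSq G F y * ∑ a, ∑ b, (G y)⁻¹ a b * G y a b) := by
      simp only [scalarCurv, gradSq, hR, Finset.mul_sum, ← Finset.sum_sub_distrib]
      exact Finset.sum_congr rfl fun a _ => Finset.sum_congr rfl fun b _ => by ring
    rw [h4, h2, sum_inv_mul_sqTensor]
    ring
  rw [hR, h3]
  ring

end Trace

/-! ### The raised Maxwell field, and the specialisation to vanishing potential. -/

/-- The contravariant components `Fᵃᵇ` of `F = dA`. -/
def curlUpUp (h : (Fin 3 → ℝ) → Matrix (Fin 3) (Fin 3) ℝ) (A : (Fin 3 → ℝ) → Fin 3 → ℝ)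
    (y : Fin 3 → ℝ) (a b : Fin 3) : ℝ :=
  -∑ d, (h y)⁻¹ b d * curlUp h A y d a

lemma curl_zero (y : Fin 3 → ℝ) (i j : Fin 3) : curl 0 y i j = 0 := by
  simp [curl, pd_const]

lemma curlUp_zero (h : (Fin 3 → ℝ) → Matrix (Fin 3) (Fin 3) ℝ) (y : Fin 3 → ℝ) (i j : Fin 3) :
    curlUp h 0 y i j = 0 := by
  simp [curlUp, curl_zero]

lemma extCov_zero (b : Fin 3 ⊕ Unit) : extCov 0 b = 0 := by
  rcases b with b | b <;> rfl

/-- For `A = 0` the adapted frame is the coordinate frame. -/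
lemma frameConn_zero (o : (Fin 3 → ℝ) → Fin 3 ⊕ Unit → Fin 3 ⊕ Unit → Fin 3 ⊕ Unit → ℝ) :
    frameConn o 0 = o := by
  ext y c a b
  have h1 : basePd a (fun _ => 0) y = 0 := by
    rcases a with a | a <;> simp [basePd, pd_const]
  rcases c with c | ⟨⟩ <;> simp [frameConn, frameSum, extCov_zero, h1]

lemma frameRicci_kkCoeff_zero_inr_inl (ε : ℝ) (h : (Fin 3 → ℝ) → Matrix (Fin 3) (Fin 3) ℝ)
    (s : (Fin 3 → ℝ) → ℝ) (y : Fin 3 → ℝ) (k : Fin 3) :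
    frameRicci (kkCoeff ε h s 0) 0 y (.inr ()) (.inl k) = 0 := by
  simp [frameRicci, baseRicci, basePd, kkCoeff_inl_inr_inl, kkCoeff_inl_inl_inr,
    kkCoeff_inr_inl_inl, kkCoeff_inr_inr_inr, curlUp_zero, curl_zero, pd_const]

lemma frameRicci_kkCoeff_zero_inl_inr (ε : ℝ) (h : (Fin 3 → ℝ) → Matrix (Fin 3) (Fin 3) ℝ)
    (s : (Fin 3 → ℝ) → ℝ) (y : Fin 3 → ℝ) (k : Fin 3) :
    frameRicci (kkCoeff ε h s 0) 0 y (.inl k) (.inr ()) = 0 := by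
  simp [frameRicci, baseRicci, basePd, kkCoeff_inl_inl_inr,
    kkCoeff_inr_inl_inl, kkCoeff_inr_inr_inr, curlUp_zero, curl_zero, pd_const]

namespace IsKKData
variable {ε : ℝ} {U : Set (Fin 3 → ℝ)} {h : (Fin 3 → ℝ) → Matrix (Fin 3) (Fin 3) ℝ}
  {s : (Fin 3 → ℝ) → ℝ} {A : (Fin 3 → ℝ) → Fin 3 → ℝ} {y : Fin 3 → ℝ}

/-- With `c = 1/2` this passes from the data of g to those of G. -/
lemma const_mul (D : IsKKData U h s A) (c : ℝ) : IsKKData U h (fun z => c * s z) 0 where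
  isOpen := D.isOpen
  metric := D.metric
  symm := D.symm
  det := D.det
  scalar := contDiffOn_const.mul D.scalar
  potential _ := contDiffOn_const

section
variable (D : IsKKData U h s A) (hy : y ∈ U)
include D hy

lemma curlUpUp_eq (a b : Fin 3) :
    curlUpUp h A y a b = ∑ c, ∑ d, (h y)⁻¹ a c * (h y)⁻¹ b d * curl A y c d := by
  rw [Finset.sum_comm]
  simp only [curlUpUp, curlUp, ← Finset.sum_neg_distrib, Finset.mul_sum]
  exact Finset.sum_congr rfl fun d _ => Finset.sum_congr rfl fun c _ => by
    rw [curl_antisymm A y c d, D.inverse_symm a c]; ring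

lemma curlUpUp_antisymm (a b : Fin 3) : curlUpUp h A y a b = -curlUpUp h A y b a := by
  rw [D.curlUpUp_eq hy, D.curlUpUp_eq hy, Finset.sum_comm]
  simp only [← Finset.sum_neg_distrib]
  exact Finset.sum_congr rfl fun d _ => Finset.sum_congr rfl fun c _ => by
    rw [curl_antisymm A y c d]; ring

lemma differentiableAt_curlUpUp (a b : Fin 3) :
    DifferentiableAt ℝ (fun z => curlUpUp h A z a b) y :=
  (DifferentiableAt.fun_sum fun d _ => (D.differentiableAt_inv hy b d).fun_mul
    (D.differentiableAt_curlUp hy d a)).fun_neg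

/-- Since `∇h = 0`, the free index may be raised outside the divergence. The term `Γᵇₐₘ Fᵃᵐ` drops
out, being a contraction of symmetric with antisymmetric indices. -/
lemma divergence_curlUpUp (b : Fin 3) :
    ∑ a, (pd a (fun z => curlUpUp h A z a b) y - 2 * pd a s y * curlUpUp h A y a b
        + ∑ i, christoffel h y i i a * curlUpUp h A y a b)
      = -∑ j, (h y)⁻¹ b j * ∑ i, (pd i (fun z => curlUp h A z j i) y
        - 2 * pd i s y * curlUp h A y j i + ∑ p, (christoffel h y i i p * curlUp h A y j p
        - christoffel h y i j p * curlUp h A y i p)) := by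
  have h1 : ∀ a, pd a (fun z => curlUpUp h A z a b) y = -∑ d,
      (pd a (fun z => (h z)⁻¹ b d) y * curlUp h A y d a
        + (h y)⁻¹ b d * pd a (fun z => curlUp h A z d a) y) := by
    intro a
    unfold curlUpUp
    rw [pd_neg, pd_sum _ _ fun d _ => (D.differentiableAt_inv hy b d).fun_mul
      (D.differentiableAt_curlUp hy d a)]
    exact congrArg _ (Finset.sum_congr rfl fun d _ =>
      pd_mul a (D.differentiableAt_inv hy b d) (D.differentiableAt_curlUp hy d a))
  have h2 : ∑ a, ∑ m, christoffel h y b a m * curlUpUp h A y a m = 0 := by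
    have h3 : ∑ a, ∑ m, christoffel h y b a m * curlUpUp h A y a m
        = -∑ a, ∑ m, christoffel h y b a m * curlUpUp h A y a m := by
      conv_lhs => rw [Finset.sum_comm]
      simp only [← Finset.sum_neg_distrib]
      exact Finset.sum_congr rfl fun a _ => Finset.sum_congr rfl fun m _ => by
        rw [D.curlUpUp_antisymm hy, christoffel_symm D.symm b m a]; ring
    linarith
  have h4 := christoffel_symm (g := h) (y := y) D.symm
  simp only [h1, D.pd_inverse hy]
  simp only [curlUpUp, Fin.sum_univ_three] at h2 ⊢
  simp only [h4 _ 1 0, h4 _ 2 0, h4 _ 2 1] at h2 ⊢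
  linear_combination -h2

/-- The fibre lowers 3/2 to 1: the full volume density is `e^s √|det h|`. -/
lemma kkCoeff_trace (k : Fin 3) :
    ∑ i, kkCoeff ε h s A y i i (.inl k) = ∑ i, christoffel h y i i k + pd k s y := by
  have h1 := D.sum_kkCoeff_trace (ε := ε) (A := A) hy k
  simp only [Fintype.sum_sum_type, Finset.univ_unique, Finset.sum_singleton,
    PUnit.default_eq_unit, kkCoeff_inr_inr_inl, h1]
  ring

/-- The conformal correction contracts to `(1/2)(1 + 1 - 3) = -1/2` times the gradient, 3 being the
trace of h. -/
lemma sum_inv_mul_kkCoeff (k : Fin 3) :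
    ∑ i, ∑ j, (h y)⁻¹ i j * kkCoeff ε h s A y (.inl k) (.inl i) (.inl j)
      = ∑ i, ∑ j, (h y)⁻¹ i j * christoffel h y k i j - 1 / 2 * gradUp h s y k := by
  have h1 := D.inverse_symm (y := y)
  have h2 : ∑ i, ∑ j, (h y)⁻¹ i j * h y i j = 3 := by
    have : ∀ i, ∑ j, (h y)⁻¹ i j * h y i j = 1 := fun i => by
      have := D.sum_inv_mul hy i i
      rw [if_pos rfl] at this
      rw [← this]
      exact Finset.sum_congr rfl fun j _ => by rw [D.symm y i j]
    simp [this]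
  simp only [Fin.sum_univ_three] at h2
  simp only [kkCoeff, gradUp, Fin.sum_univ_three]
  fin_cases k <;> simp [h1 1 0, h1 2 0, h1 2 1] at h2 ⊢
  · linear_combination -1 / 2 * (pd 0 s y * (h y)⁻¹ 0 0 + pd 1 s y * (h y)⁻¹ 0 1
      + pd 2 s y * (h y)⁻¹ 0 2) * h2
  · linear_combination -1 / 2 * (pd 0 s y * (h y)⁻¹ 0 1 + pd 1 s y * (h y)⁻¹ 1 1
      + pd 2 s y * (h y)⁻¹ 1 2) * h2
  · linear_combination -1 / 2 * (pd 0 s y * (h y)⁻¹ 0 2 + pd 1 s y * (h y)⁻¹ 1 2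
      + pd 2 s y * (h y)⁻¹ 2 2) * h2

lemma box_const_mul (c : ℝ) : box h (fun z => c * s z) y = c * box h s y := by
  have h1 : ∀ j, ∀ z ∈ U, pd j (fun z => c * s z) z = c * pd j s z := fun j z hz =>
    pd_const_mul j c (D.differentiableAt_scalar hz)
  have h2 : ∀ i j, pd i (pd j fun z => c * s z) y = c * pd i (pd j s) y := fun i j => by
    rw [← pd_const_mul i c (D.differentiableAt_pd_scalar hy j)]
    exact pd_congr_of_eqOn D.isOpen hy fun z hz => h1 j z hz
  simp only [box, h2, h1 _ y hy, Finset.mul_sum]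
  refine Finset.sum_congr rfl fun i _ => Finset.sum_congr rfl fun j _ => ?_
  rw [mul_left_comm c, mul_sub c, Finset.mul_sum]
  congr 2
  exact Finset.sum_congr rfl fun k _ => by ring

end

end IsKKData

/-! ### Consequences of Ricci-flatness of g, and the tensors built from G and F. -/

/-- The pull-back to `W × ℝ` of the metric `exp(s) h + ε exp(-s) (dθ + A)²`. -/
abbrev kkPull (ε : ℝ) (h : (Fin 3 → ℝ) → Matrix (Fin 3) (Fin 3) ℝ) (s : (Fin 3 → ℝ) → ℝ)
    (A : (Fin 3 → ℝ) → Fin 3 → ℝ) (p : Fin 3 ⊕ Unit → ℝ) :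
    Matrix (Fin 3 ⊕ Unit) (Fin 3 ⊕ Unit) ℝ :=
  kkMetric ε h s A (baseCoord p)

lemma pd_pullTwoForm {U : Set (Fin 3 → ℝ)} (hU : IsOpen U)
    {f : (Fin 3 → ℝ) → Matrix (Fin 3) (Fin 3) ℝ} {A : (Fin 3 → ℝ) → Fin 3 → ℝ}
    (hf : ∀ y ∈ U, ∀ i j, f y i j = curl A y i j)
    (hd : ∀ y ∈ U, ∀ i j, DifferentiableAt ℝ (fun z => curl A z i j) y)
    {q : Fin 3 ⊕ Unit → ℝ} (hq : baseCoord q ∈ U) (a : Fin 3 ⊕ Unit) (i j : Fin 3) :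
    pd a (fun z => pullTwoForm f z (.inl i) (.inl j)) q
      = basePd a (fun z => curl A z i j) (baseCoord q) := by
  rw [← pd_baseCoord a (hd _ hq i j)]
  exact pd_congr_of_eqOn (hU.preimage continuous_baseCoord) hq fun z hz => hf _ hz i j

namespace IsKKData
variable {U : Set (Fin 3 → ℝ)} {h : (Fin 3 → ℝ) → Matrix (Fin 3) (Fin 3) ℝ}
  {s : (Fin 3 → ℝ) → ℝ} {A : (Fin 3 → ℝ) → Fin 3 → ℝ} {y : Fin 3 → ℝ}
  {f : (Fin 3 → ℝ) → Matrix (Fin 3) (Fin 3) ℝ} {q : Fin 3 ⊕ Unit → ℝ}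

lemma kkPull_inv_inl_inl (D : IsKKData U h s 0) (hq : baseCoord q ∈ U) (i j : Fin 3) :
    (kkPull 1 h s 0 q)⁻¹ (.inl i) (.inl j)
      = Real.exp (-s (baseCoord q)) * (h (baseCoord q))⁻¹ i j := by
  rw [kkPull, D.kkMetric_inv hq (by norm_num)]; rfl

lemma kkPull_inv_inl_inr (D : IsKKData U h s 0) (hq : baseCoord q ∈ U) (i : Fin 3) (u : Unit) :
    (kkPull 1 h s 0 q)⁻¹ (.inl i) (.inr u) = 0 := by
  rw [kkPull, D.kkMetric_inv hq (by norm_num)]; simp [kkInverse]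

lemma kkPull_inv_inr_inl (D : IsKKData U h s 0) (hq : baseCoord q ∈ U) (i : Fin 3) (u : Unit) :
    (kkPull 1 h s 0 q)⁻¹ (.inr u) (.inl i) = 0 := by
  rw [kkPull, D.kkMetric_inv hq (by norm_num)]; simp [kkInverse]

lemma kkPull_inv_inr_inr (D : IsKKData U h s 0) (hq : baseCoord q ∈ U) (u v : Unit) :
    (kkPull 1 h s 0 q)⁻¹ (.inr u) (.inr v) = Real.exp (s (baseCoord q)) := by
  rw [kkPull, D.kkMetric_inv hq (by norm_num)]; simp [kkInverse]

lemma christoffel_kkPull_zero (D : IsKKData U h s 0) (hq : baseCoord q ∈ U) :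
    christoffel (kkPull 1 h s 0) q = kkCoeff 1 h s 0 (baseCoord q) := by
  rw [← frameConn_zero (kkCoeff 1 h s 0)]
  exact D.christoffel_kkMetric (by norm_num) hq

lemma ricci_kkPull_zero (D : IsKKData U h s 0) (hq : baseCoord q ∈ U) (j k : Fin 3 ⊕ Unit) :
    ricci (christoffel (kkPull 1 h s 0)) q j k
      = frameRicci (kkCoeff 1 h s 0) 0 (baseCoord q) j k := by
  rw [show kkPull 1 h s 0 = fun p => kkMetric 1 h s 0 (baseCoord p) from rfl,
    D.ricci_kkMetric (by norm_num) hq]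
  simp [extCov_zero]

/-- The passage from frame to coordinate components is triangular, so the fibre-fibre component
vanishes, then the mixed ones, then the horizontal ones. -/
lemma frameRicci_eq_zero (D : IsKKData U h s A) (hq : baseCoord q ∈ U)
    (hflat : ∀ a b, ricci (christoffel (kkPull (-1) h s A)) q a b = 0) (j k : Fin 3 ⊕ Unit) :
    frameRicci (kkCoeff (-1) h s A) A (baseCoord q) j k = 0 := by
  have h1 : ∀ j k, _ = (0 : ℝ) := fun j k =>
    (D.ricci_kkMetric (ε := -1) (by norm_num) hq j k).symm.trans (hflat j k)
  have h2 := h1 (.inr ()) (.inr ())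
  simp only [extCov_inr, zero_mul, add_zero] at h2
  have h3 : ∀ i, frameRicci (kkCoeff (-1) h s A) A (baseCoord q) (.inl i) (.inr ()) = 0 := by
    intro i
    have := h1 (.inl i) (.inr ())
    simpa only [extCov_inr, zero_mul, add_zero, mul_zero, h2] using this
  have h4 : ∀ i, frameRicci (kkCoeff (-1) h s A) A (baseCoord q) (.inr ()) (.inl i) = 0 := by
    intro i
    have := h1 (.inr ()) (.inl i)
    simpa only [extCov_inr, zero_mul, add_zero, mul_zero, h2] using this
  rcases j with j | ⟨⟩ <;> rcases k with k | ⟨⟩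
  · have := h1 (.inl j) (.inl k)
    simpa only [h2, h3, h4, mul_zero, add_zero] using this
  · exact h3 j
  · exact h4 k
  · exact h2

lemma sum_curl_mul_curlUpUp :
    ∑ i, ∑ j, curl A y i j * curlUpUp h A y i j
      = -∑ i, ∑ k, curlUp h A y i k * curlUp h A y k i := by
  simp only [curlUpUp, mul_neg, Finset.sum_neg_distrib, Finset.mul_sum]
  congr 1
  refine Finset.sum_congr rfl fun i _ => ?_
  rw [Finset.sum_comm]
  refine Finset.sum_congr rfl fun d _ => ?_
  rw [show curlUp h A y i d = ∑ l, curl A y i l * (h y)⁻¹ l d from rfl, Finset.sum_mul]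
  exact Finset.sum_congr rfl fun j _ => by ring

/-- The fibre-fibre component of flatness, divided by `e^{-2s}`. -/
lemma box_of_flat (D : IsKKData U h s A) (hy : y ∈ U)
    (hR : frameRicci (kkCoeff (-1) h s A) A y (.inr ()) (.inr ()) = 0) :
    box h s y = 1 / 2 * Real.exp (-s y) ^ 2 * ∑ i, ∑ j, curl A y i j * curlUpUp h A y i j := by
  rw [D.frameRicci_inr_inr hy (by norm_num)] at hR
  rw [sum_curl_mul_curlUpUp]
  have h1 : Real.exp (-s y) ^ 2 ≠ 0 := by positivity
  apply mul_left_cancel₀ h1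
  linear_combination -2 * hR

/-- The mixed components of flatness, raised: this is `∇ₐ(e^{-2s} Fᵃᵇ) = 0` for h, up to the factor
`e^{-2s}`. -/
lemma maxwell_of_flat (D : IsKKData U h s A) (hy : y ∈ U)
    (hR : ∀ j, frameRicci (kkCoeff (-1) h s A) A y (.inl j) (.inr ()) = 0) (b : Fin 3) :
    ∑ a, (pd a (fun z => curlUpUp h A z a b) y - 2 * pd a s y * curlUpUp h A y a b
        + ∑ i, christoffel h y i i a * curlUpUp h A y a b) = 0 := by
  rw [D.divergence_curlUpUp hy, neg_eq_zero]
  refine Finset.sum_eq_zero fun j _ => ?_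
  have h1 := hR j
  rw [D.frameRicci_inl_inr hy] at h1
  have h2 : -1 / 2 * Real.exp (-s y) ^ 2 ≠ 0 := by
    have := Real.exp_pos (-s y)
    exact mul_ne_zero (by norm_num) (by positivity)
  rw [(mul_eq_zero.mp h1).resolve_left h2, mul_zero]

section
variable (D : IsKKData U h s 0) (hq : baseCoord q ∈ U)
include D hq

lemma raise_inl_inl {s' : (Fin 3 → ℝ) → ℝ} (D' : IsKKData U h s' A)
    (hf : ∀ i j, f (baseCoord q) i j = curl A (baseCoord q) i j) (a b : Fin 3) :
    raise (kkPull 1 h s 0) (pullTwoForm f) q (.inl a) (.inl b)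
      = Real.exp (-s (baseCoord q)) ^ 2 * curlUpUp h A (baseCoord q) a b := by
  rw [D'.curlUpUp_eq hq]
  simp only [raise, Fintype.sum_sum_type, D.kkPull_inv_inl_inl hq, D.kkPull_inv_inl_inr hq,
    pullTwoForm, Matrix.fromBlocks_apply₁₁, hf, zero_mul, mul_zero, Finset.sum_const_zero, add_zero,
    Finset.mul_sum]
  exact Finset.sum_congr rfl fun c _ => Finset.sum_congr rfl fun d _ => by ring

lemma raise_inr (a : Fin 3 ⊕ Unit) (u : Unit) :
    raise (kkPull 1 h s 0) (pullTwoForm f) q a (.inr u) = 0 := by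
  simp [raise, D.kkPull_inv_inr_inl hq, D.kkPull_inv_inr_inr hq, pullTwoForm]

lemma raise_inr_left (a : Fin 3 ⊕ Unit) (u : Unit) :
    raise (kkPull 1 h s 0) (pullTwoForm f) q (.inr u) a = 0 := by
  simp [raise, D.kkPull_inv_inr_inl hq, D.kkPull_inv_inr_inr hq, pullTwoForm]

lemma formSq_kkPull {s' : (Fin 3 → ℝ) → ℝ} (D' : IsKKData U h s' A)
    (hf : ∀ i j, f (baseCoord q) i j = curl A (baseCoord q) i j) :
    formSq (kkPull 1 h s 0) (pullTwoForm f) q = Real.exp (-s (baseCoord q)) ^ 2 *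
      ∑ i, ∑ j, curl A (baseCoord q) i j * curlUpUp h A (baseCoord q) i j := by
  simp only [formSq, Fintype.sum_sum_type, D.raise_inl_inl hq D' hf, D.raise_inr hq,
    D.raise_inr_left hq, pullTwoForm, Matrix.fromBlocks_apply₁₁, hf, mul_zero,
    Finset.sum_const_zero, add_zero, Finset.mul_sum]
  exact Finset.sum_congr rfl fun c _ => Finset.sum_congr rfl fun d _ => by ring

lemma sqTensor_inl_inl
    (hf : ∀ i j, f (baseCoord q) i j = curl A (baseCoord q) i j) (j k : Fin 3) :
    sqTensor (kkPull 1 h s 0) (pullTwoForm f) q (.inl j) (.inl k) = Real.exp (-s (baseCoord q)) *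
      ∑ p, curl A (baseCoord q) j p * curlUp h A (baseCoord q) k p := by
  simp only [sqTensor, Fintype.sum_sum_type, D.kkPull_inv_inl_inl hq,
    D.kkPull_inv_inr_inl hq, pullTwoForm, Matrix.fromBlocks_apply₁₁,
    Matrix.fromBlocks_apply₁₂, Matrix.zero_apply, hf, zero_mul, mul_zero,
    Finset.sum_const_zero, add_zero, Finset.mul_sum, curlUp]
  exact Finset.sum_congr rfl fun c _ => Finset.sum_congr rfl fun d _ => by
    rw [D.inverse_symm c d]; ring

lemma sqTensor_inr (a : Fin 3 ⊕ Unit) (u : Unit) :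
    sqTensor (kkPull 1 h s 0) (pullTwoForm f) q a (.inr u) = 0 := by
  simp [sqTensor, pullTwoForm]

lemma sqTensor_inr_left (a : Fin 3 ⊕ Unit) (u : Unit) :
    sqTensor (kkPull 1 h s 0) (pullTwoForm f) q (.inr u) a = 0 := by
  simp [sqTensor, pullTwoForm]

end

end IsKKData
-- The Einstein-Maxwell-dilaton equations on a coordinate domain.
namespace IsKKData
variable {U : Set (Fin 3 → ℝ)} {h : (Fin 3 → ℝ) → Matrix (Fin 3) (Fin 3) ℝ}
  {s : (Fin 3 → ℝ) → ℝ} {A : (Fin 3 → ℝ) → Fin 3 → ℝ} {y : Fin 3 → ℝ}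
  {f : (Fin 3 → ℝ) → Matrix (Fin 3) (Fin 3) ℝ} {q : Fin 3 ⊕ Unit → ℝ}

lemma closed_curl (D : IsKKData U h s A) (hy : y ∈ U) (a b d : Fin 3) :
    pd a (fun z => curl A z b d) y + pd b (fun z => curl A z d a) y
      + pd d (fun z => curl A z a b) y = 0 := by
  have h1 := D.differentiableAt_pd_potential hy
  have h2 : ∀ i j k, pd i (fun z => curl A z j k) y
      = pd i (pd j fun z => A z k) y - pd i (pd k fun z => A z j) y := fun i j k =>
    pd_sub i (h1 j k) (h1 k j)
  have h3 : ∀ i j k, pd i (pd j fun z => A z k) y = pd j (pd i fun z => A z k) y := fun i j k =>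
    pd_comm i j ((D.potential k).contDiffAt (D.isOpen.mem_nhds hy))
  rw [h2, h2, h2, h3 a b d, h3 a d b, h3 b d a]
  ring

lemma closed_pullTwoForm (D : IsKKData U h s A) (hf : ∀ y ∈ U, ∀ i j, f y i j = curl A y i j)
    (hq : baseCoord q ∈ U) (a b d : Fin 3 ⊕ Unit) :
    pd a (fun z => pullTwoForm f z b d) q + pd b (fun z => pullTwoForm f z d a) q
      + pd d (fun z => pullTwoForm f z a b) q = 0 := by
  have h1 := fun a i j => pd_pullTwoForm D.isOpen hf
    (fun y hy => D.differentiableAt_curl hy) hq a i j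
  have h2 : ∀ a i u, pd a (fun z => pullTwoForm f z i (.inr u)) q = 0 := by
    intro a i u
    rcases i with i | v <;> exact pd_const a 0
  have h3 : ∀ a i u, pd a (fun z => pullTwoForm f z (.inr u) i) q = 0 := by
    intro a i u
    rcases i with i | v <;> exact pd_const a 0
  rcases a with a | a <;> rcases b with b | b <;> rcases d with d | d <;>
    simp only [h1, h2, h3, basePd, add_zero]
  exact D.closed_curl hq a b d

/-- The coupling `2√3 · √3/4 = 3/2` turns the dilaton factor into `e^{-3s/2}`, a cube of `e^{-s/2}`;
this makes the remaining identities polynomial in `e^{-s/2}`. -/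
lemma dilaton_exp (t : ℝ) :
    Real.exp (2 * Real.sqrt 3 * (-(Real.sqrt 3 / 4) * t)) = Real.exp (-(1 / 2 * t)) ^ 3 := by
  rw [← Real.exp_nat_mul]
  congr 1
  have : Real.sqrt 3 * Real.sqrt 3 = 3 := Real.mul_self_sqrt (by norm_num)
  push_cast
  linear_combination -1 / 2 * t * this

lemma kkCoeff_symm (D : IsKKData U h s A) (ε : ℝ) (k i j : Fin 3) :
    kkCoeff ε h s A y (.inl k) (.inl i) (.inl j) = kkCoeff ε h s A y (.inl k) (.inl j) (.inl i) := by
  simp only [kkCoeff]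
  rw [christoffel_symm D.symm k i j, D.symm y i j]
  ring

section
variable (D : IsKKData U h s A) (hf : ∀ y ∈ U, ∀ i j, f y i j = curl A y i j)
  (hq : baseCoord q ∈ U)
include D hq

lemma exp_half : Real.exp (-s (baseCoord q)) = Real.exp (-(1 / 2 * s (baseCoord q))) ^ 2 := by
  rw [← Real.exp_nat_mul]
  congr 1
  push_cast
  ring

lemma pd_dilaton (c : ℝ) (a : Fin 3 ⊕ Unit) :
    pd a (fun p => c * s (baseCoord p)) q = c * basePd a s (baseCoord q) := by
  rw [pd_baseCoord (f := fun z => c * s z) a ((D.differentiableAt_scalar hq).const_mul c)]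
  rcases a with a | a
  · exact pd_const_mul a c (D.differentiableAt_scalar hq)
  · simp [basePd]

lemma pd_pd_dilaton (c : ℝ) (a b : Fin 3 ⊕ Unit) :
    pd a (pd b fun p => c * s (baseCoord p)) q = c * basePd a (basePd b s) (baseCoord q) := by
  have h1 : DifferentiableAt ℝ (fun z => basePd b s z) (baseCoord q) := by
    rcases b with b | b
    · exact D.differentiableAt_pd_scalar hq b
    · exact differentiableAt_const _
  have h2 : pd a (pd b fun p => c * s (baseCoord p)) q
      = pd a (fun p => c * basePd b s (baseCoord p)) q :=
    pd_congr_of_eqOn (D.isOpen.preimage continuous_baseCoord) hq fun p hp => D.pd_dilaton hp c b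
  rw [h2, pd_baseCoord (f := fun z => c * basePd b s z) a (h1.const_mul c)]
  rcases a with a | a
  · exact pd_const_mul a c h1
  · simp [basePd]

include hf in
lemma ricci_emd (hR : ∀ a b, frameRicci (kkCoeff (-1) h s A) A (baseCoord q) a b = 0)
    (a b : Fin 3 ⊕ Unit) :
    ricci (christoffel (kkPull 1 h (fun z => 1 / 2 * s z) 0)) q a b
      = 2 * (pd a (fun p => -(Real.sqrt 3 / 4) * s (baseCoord p)) q
          * pd b (fun p => -(Real.sqrt 3 / 4) * s (baseCoord p)) q)
        - 1 / 2 * Real.exp (2 * Real.sqrt 3 * (-(Real.sqrt 3 / 4) * s (baseCoord q)))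
          * (sqTensor (kkPull 1 h (fun z => 1 / 2 * s z) 0) (pullTwoForm f) q a b
            - 1 / 4 * formSq (kkPull 1 h (fun z => 1 / 2 * s z) 0) (pullTwoForm f) q
              * kkPull 1 h (fun z => 1 / 2 * s z) 0 q a b) := by
  have D' := D.const_mul (1 / 2)
  have h3 : Real.sqrt 3 * Real.sqrt 3 = 3 := Real.mul_self_sqrt (by norm_num)
  have hbox := D.box_of_flat hq (hR _ _)
  have hf' := hf _ hq
  have hE : Real.exp (1 / 2 * s (baseCoord q)) * Real.exp (-(1 / 2 * s (baseCoord q))) = 1 := by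
    rw [← Real.exp_add]; simp
  have hs : ∀ i, pd i (fun z => 1 / 2 * s z) (baseCoord q) = 1 / 2 * pd i s (baseCoord q) :=
    fun i => pd_const_mul i _ (D.differentiableAt_scalar hq)
  have he := D.exp_half hq
  rw [he] at hbox
  rw [D'.ricci_kkPull_zero hq, dilaton_exp, D.pd_dilaton hq, D.pd_dilaton hq,
    D'.formSq_kkPull hq D hf']
  rcases a with j | ⟨⟩ <;> rcases b with k | ⟨⟩
  · have hjk := hR (.inl j) (.inl k)
    rw [D.frameRicci_inl_inl hq, he] at hjk
    rw [D'.frameRicci_inl_inl hq, D'.sqTensor_inl_inl hq hf', D.box_const_mul hq, hs, hs]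
    simp only [curl_zero, zero_mul, Finset.sum_const_zero, basePd, kkPull, kkMetric,
      Matrix.fromBlocks_apply₁₁, Matrix.of_apply, Pi.zero_apply, mul_zero, add_zero]
    -- Eliminating `Ric(h)` by `hjk` leaves `(1/2 - 1/4) h □s` and `(1/2 - 1/8) ∂ⱼs ∂ₖs`. The first
    -- is the `F²` trace term by `hbox`, the second is `2 ∂ⱼΦ ∂ₖΦ` because `2 · 3/16 = 3/8`.
    linear_combination hjk + 1 / 4 * h (baseCoord q) j k * hbox
      - 1 / 8 * (pd j s (baseCoord q) * pd k s (baseCoord q)) * h3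
      - 1 / 8 * Real.exp (-(1 / 2 * s (baseCoord q))) ^ 4 * h (baseCoord q) j k
        * (∑ i, ∑ j, curl A (baseCoord q) i j * curlUpUp h A (baseCoord q) i j) * hE
  · rw [frameRicci_kkCoeff_zero_inl_inr, D'.sqTensor_inr hq]
    simp [basePd, kkMetric]
  · rw [frameRicci_kkCoeff_zero_inr_inl, D'.sqTensor_inr_left hq]
    simp [basePd, kkMetric]
  · rw [D'.frameRicci_inr_inr hq (by norm_num), D'.sqTensor_inr hq, D.box_const_mul hq, hbox]
    simp only [curlUp_zero, mul_zero, Finset.sum_const_zero, basePd, kkPull, kkMetric,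
      Matrix.fromBlocks_apply₂₂, Matrix.of_apply]
    ring

include hf in
lemma maxwell_emd (hR : ∀ a b, frameRicci (kkCoeff (-1) h s A) A (baseCoord q) a b = 0)
    (b : Fin 3 ⊕ Unit) :
    divergence (kkPull 1 h (fun z => 1 / 2 * s z) 0)
      (fun p a b => Real.exp (2 * Real.sqrt 3 * (-(Real.sqrt 3 / 4) * s (baseCoord p)))
        * raise (kkPull 1 h (fun z => 1 / 2 * s z) 0) (pullTwoForm f) p a b) q b = 0 := by
  have D' := D.const_mul (1 / 2)
  -- The exponent 5/2 is 3/2 from the dilaton plus 1/2 for each of the two raised indices. The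
  -- volume density of G later contributes `+1/2`, leaving the weight `-2` of `maxwell_of_flat`.
  have hT : ∀ p, baseCoord p ∈ U → ∀ a b,
      Real.exp (2 * Real.sqrt 3 * (-(Real.sqrt 3 / 4) * s (baseCoord p)))
        * raise (kkPull 1 h (fun z => 1 / 2 * s z) 0) (pullTwoForm f) p (.inl a) (.inl b)
      = Real.exp (-(5 / 2 * s (baseCoord p))) * curlUpUp h A (baseCoord p) a b := by
    intro p hp a b
    rw [D'.raise_inl_inl hp D (hf _ hp), dilaton_exp, ← mul_assoc, ← pow_add, ← Real.exp_nat_mul]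
    congr 2
    push_cast
    ring
  have hpd : ∀ l a b, pd l (fun p => Real.exp (2 * Real.sqrt 3 * (-(Real.sqrt 3 / 4)
        * s (baseCoord p))) * raise (kkPull 1 h (fun z => 1 / 2 * s z) 0) (pullTwoForm f) p
          (.inl a) (.inl b)) q
      = basePd l (fun z => Real.exp (-(5 / 2 * s z)) * curlUpUp h A z a b) (baseCoord q) := by
    intro l a b
    have h1 := D.differentiableAt_scalar hq
    have h2 := D.differentiableAt_curlUpUp hq a b
    rw [← pd_baseCoord (f := fun z => Real.exp (-(5 / 2 * s z)) * curlUpUp h A z a b) l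
      (by fun_prop)]
    exact pd_congr_of_eqOn (D.isOpen.preimage continuous_baseCoord) hq fun p hp => hT p hp a b
  have hpd_inr : ∀ l a u, pd l (fun p => Real.exp (2 * Real.sqrt 3 * (-(Real.sqrt 3 / 4)
        * s (baseCoord p))) * raise (kkPull 1 h (fun z => 1 / 2 * s z) 0) (pullTwoForm f) p
          a (.inr u)) q = 0 := by
    intro l a u
    rw [← pd_const (y := q) l 0]
    exact pd_congr_of_eqOn (D.isOpen.preimage continuous_baseCoord) hq fun p hp => by
      rw [D'.raise_inr hp, mul_zero]
  have hpd_inr_left : ∀ l a u, pd l (fun p => Real.exp (2 * Real.sqrt 3 * (-(Real.sqrt 3 / 4)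
        * s (baseCoord p))) * raise (kkPull 1 h (fun z => 1 / 2 * s z) 0) (pullTwoForm f) p
          (.inr u) a) q = 0 := by
    intro l a u
    rw [← pd_const (y := q) l 0]
    exact pd_congr_of_eqOn (D.isOpen.preimage continuous_baseCoord) hq fun p hp => by
      rw [D'.raise_inr_left hp, mul_zero]
  rcases b with b | ⟨⟩
  · have h1 := D.differentiableAt_scalar hq
    have h2 := fun a b => D.differentiableAt_curlUpUp hq a b
    have h3 := D.maxwell_of_flat hq (fun j => hR _ _) b
    have h4 := D'.kkCoeff_trace (ε := 1) hq
    have h5 : ∀ i, pd i (fun z => 1 / 2 * s z) (baseCoord q) = 1 / 2 * pd i s (baseCoord q) :=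
      fun i => pd_const_mul i _ h1
    have h6 : ∀ a, pd a (fun z => Real.exp (-(5 / 2 * s z)) * curlUpUp h A z a b) (baseCoord q)
        = Real.exp (-(5 / 2 * s (baseCoord q))) * (pd a (fun z => curlUpUp h A z a b) (baseCoord q)
          - 5 / 2 * pd a s (baseCoord q) * curlUpUp h A (baseCoord q) a b) := by
      intro a
      have h2 := h2 a b
      simp (disch := fun_prop) only [pd_mul, pd_const, pd_exp, pd_neg]
      ring
    have h7 : ∑ a, ∑ m, kkCoeff 1 h (fun z => 1 / 2 * s z) 0 (baseCoord q) (.inl b) (.inl a) (.inl m)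
        * curlUpUp h A (baseCoord q) a m = 0 := by
      rw [← self_eq_neg]
      conv_lhs => rw [Finset.sum_comm]
      simp only [← Finset.sum_neg_distrib]
      exact Finset.sum_congr rfl fun a _ => Finset.sum_congr rfl fun m _ => by
        rw [D.curlUpUp_antisymm hq, D'.kkCoeff_symm]; ring
    simp only [divergence, D'.christoffel_kkPull_zero hq, Fintype.sum_sum_type, hpd,
      hpd_inr_left, hT q hq, D'.raise_inr hq, D'.raise_inr_left hq, basePd, h6]
    simp only [h5, Fintype.sum_sum_type, Fin.sum_univ_three, Finset.univ_unique,
      Finset.sum_singleton, PUnit.default_eq_unit] at h3 h4 h7 ⊢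
    linear_combination Real.exp (-(5 / 2 * s (baseCoord q))) * (h3 + h7
      + curlUpUp h A (baseCoord q) 0 b * h4 0 + curlUpUp h A (baseCoord q) 1 b * h4 1
      + curlUpUp h A (baseCoord q) 2 b * h4 2)
  · simp only [divergence, D'.christoffel_kkPull_zero hq, Fintype.sum_sum_type, hpd_inr,
      D'.raise_inr hq, D'.raise_inr_left hq, kkCoeff_inr_inl_inl, curl_zero]
    simp

include hf in
lemma dilaton_emd (hR : ∀ a b, frameRicci (kkCoeff (-1) h s A) A (baseCoord q) a b = 0) :
    4 * box (kkPull 1 h (fun z => 1 / 2 * s z) 0) (fun p => -(Real.sqrt 3 / 4) * s (baseCoord p)) q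
      + 1 / 4 * (2 * Real.sqrt 3) *
        Real.exp (2 * Real.sqrt 3 * (-(Real.sqrt 3 / 4) * s (baseCoord q)))
        * formSq (kkPull 1 h (fun z => 1 / 2 * s z) 0) (pullTwoForm f) q = 0 := by
  have D' := D.const_mul (1 / 2)
  have hbox := D.box_of_flat hq (hR _ _)
  have he := D.exp_half hq
  have hE : Real.exp (1 / 2 * s (baseCoord q)) * Real.exp (-(1 / 2 * s (baseCoord q))) = 1 := by
    rw [← Real.exp_add]; simp
  have h1 := D'.sum_inv_mul_kkCoeff (ε := 1) hq
  have hs : ∀ i, pd i (fun z => 1 / 2 * s z) (baseCoord q) = 1 / 2 * pd i s (baseCoord q) :=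
    fun i => pd_const_mul i _ (D.differentiableAt_scalar hq)
  have hg : ∀ k, gradUp h (fun z => 1 / 2 * s z) (baseCoord q) k
      = 1 / 2 * gradUp h s (baseCoord q) k := by
    intro k
    simp only [gradUp, hs, Finset.mul_sum]
    exact Finset.sum_congr rfl fun _ _ => by ring
  -- On functions of the base `√|det G| Gⁱʲ = √|det h| hⁱʲ`, so the wave operator of G is `e^{-s/2}`
  -- times that of h. In coordinates, the gradient terms from the base and from the fibre cancel.
  have key : box (kkPull 1 h (fun z => 1 / 2 * s z) 0)
      (fun p => -(Real.sqrt 3 / 4) * s (baseCoord p)) q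
      = Real.exp (-(1 / 2 * s (baseCoord q))) * (-(Real.sqrt 3 / 4)) * box h s (baseCoord q) := by
    have hb : ∀ i, basePd (.inl i) s = pd i s := fun _ => rfl
    simp only [hg, Fin.sum_univ_three] at h1
    simp only [box, D.pd_dilaton hq, D.pd_pd_dilaton hq, D'.christoffel_kkPull_zero hq,
      Fintype.sum_sum_type, D'.kkPull_inv_inl_inl hq, D'.kkPull_inv_inl_inr hq,
      D'.kkPull_inv_inr_inl hq, D'.kkPull_inv_inr_inr hq, hb, basePd, Finset.univ_unique,
      Finset.sum_singleton, PUnit.default_eq_unit, kkCoeff_inl_inr_inr, hg, Fin.sum_univ_three]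
    linear_combination (-(Real.sqrt 3 / 4)) * Real.exp (-(1 / 2 * s (baseCoord q))) *
      (-h1 0 * pd 0 s (baseCoord q) - h1 1 * pd 1 s (baseCoord q) - h1 2 * pd 2 s (baseCoord q)
        - 1 / 4 * hE * (gradUp h s (baseCoord q) 0 * pd 0 s (baseCoord q)
          + gradUp h s (baseCoord q) 1 * pd 1 s (baseCoord q)
          + gradUp h s (baseCoord q) 2 * pd 2 s (baseCoord q)))
  rw [key, hbox, he, dilaton_exp, D'.formSq_kkPull hq D (hf _ hq)]
  ring
end

end IsKKData

/-- The Einstein-Maxwell-dilaton equations from the Ricci-flatness of `exp(s) h - exp(-s) (dθ + A)²`,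
on a coordinate domain. -/
theorem IsKKData.isEMDSolution {U : Set (Fin 3 → ℝ)} {h : (Fin 3 → ℝ) → Matrix (Fin 3) (Fin 3) ℝ}
    {s : (Fin 3 → ℝ) → ℝ} {A : (Fin 3 → ℝ) → Fin 3 → ℝ}
    {f : (Fin 3 → ℝ) → Matrix (Fin 3) (Fin 3) ℝ} (D : IsKKData U h s A)
    (hf : ∀ y ∈ U, ∀ i j, f y i j = curl A y i j)
    (hflat : ∀ q, baseCoord q ∈ U → ∀ a b, ricci (christoffel (kkPull (-1) h s A)) q a b = 0) :
    IsEMDSolution (1 / 4) (2 * Real.sqrt 3) (kkPull 1 h (fun z => 1 / 2 * s z) 0)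
      (fun q => -(Real.sqrt 3 / 4) * s (baseCoord q)) (pullTwoForm f) {q | baseCoord q ∈ U} where
  antisymm q hq a b := by
    rcases a with a | a <;> rcases b with b | b <;> simp only [pullTwoForm,
      Matrix.fromBlocks_apply₁₁, Matrix.fromBlocks_apply₁₂, Matrix.fromBlocks_apply₂₁,
      Matrix.fromBlocks_apply₂₂, Matrix.zero_apply, neg_zero]
    rw [hf _ hq, hf _ hq, curl_antisymm]
  closed q hq := D.closed_pullTwoForm hf hq
  einstein q hq a b := by
    have hR := fun a b => D.frameRicci_eq_zero hq (hflat q hq) a b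
    have D' := D.const_mul (1 / 2)
    refine einstein_of_traceReversed (by simp) ?_ (fun a b => ?_) _ (fun a b => ?_) a b
    · rw [kkPull, D'.kkMetric_inv hq (by norm_num), D'.kkInverse_mul_kkMetric hq (by norm_num)]
    · rcases a with a | a <;> rcases b with b | b <;>
        simp [kkMetric]
      exact D.symm _ a b
    · rw [D.ricci_emd hf hq hR]
      norm_num
  maxwell q hq b := D.maxwell_emd hf hq (fun a b => D.frameRicci_eq_zero hq (hflat q hq) a b) b
  dilaton q hq := D.dilaton_emd hf hq (fun a b => D.frameRicci_eq_zero hq (hflat q hq) a b)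

/-! ### From the manifold to a chart. -/

lemma sum_smul_map_single {E : Type*} [AddCommGroup E] [Module ℝ E]
    (L : (Fin 3 → ℝ) →ₗ[ℝ] E) (w : Fin 3 → ℝ) : ∑ j, w j • L (Pi.single j 1) = L w := by
  simp only [← map_smul, ← map_sum]
  congr 1
  ext i
  simp [Pi.single_apply]

section Charts

variable {W : Type*} [TopologicalSpace W] [ChartedSpace (Fin 3 → ℝ) W] [IsManifold I3 ∞ W]
  {φ : OpenPartialHomeomorph W (Fin 3 → ℝ)}

lemma sum_coordVec (hφ : φ ∈ charts W) {x : W} (hx : x ∈ φ.source) (v : TangentSpace I3 x) :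
    ∑ j, (mfderiv I3 I3 φ x v : Fin 3 → ℝ) j • coordVec φ j x = v := by
  have h1 : φ ∈ IsManifold.maximalAtlas I3 1 W :=
    IsManifold.maximalAtlas_subset_of_le (by norm_cast) hφ
  have hd : φ.MDifferentiable I3 I3 :=
    ⟨fun x hx => (mdifferentiableAt_of_mem_maximalAtlas h1 hx).mdifferentiableWithinAt,
      fun y hy => (mdifferentiableAt_symm_of_mem_maximalAtlas h1 hy).mdifferentiableWithinAt⟩
  have h2 : mfderiv I3 I3 φ x = (hd.mfderiv hx : TangentSpace I3 x →L[ℝ] TangentSpace I3 (φ x)) :=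
    rfl
  -- On the chart domain the differential is an equivalence, so `inverse` is the true inverse and
  -- not its default value.
  have h3 : (mfderiv I3 I3 φ x).inverse = ((hd.mfderiv hx).symm : _ →L[ℝ] _) := by
    rw [h2, ContinuousLinearMap.inverse_equiv]
  simp only [coordVec, h3]
  have h4 := sum_smul_map_single (E := TangentSpace I3 x)
    (hd.mfderiv hx).symm.toLinearEquiv.toLinearMap (mfderiv I3 I3 φ x v)
  exact h4.trans ((hd.mfderiv hx).symm_apply_apply v)

/-- Written in an orthonormal frame, the Gram matrix gives `M h Mᵀ = diag(1, 1, -1)`, whose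
determinant is not zero. -/
lemma det_comp2_ne_zero (h : LorentzMetric W) (hφ : φ ∈ charts W) {y : Fin 3 → ℝ}
    (hy : y ∈ φ.target) : (comp2 h.toFun φ y).det ≠ 0 := by
  set x := φ.symm y with hx
  obtain ⟨e, he⟩ := h.lorentzian x
  set M : Matrix (Fin 3) (Fin 3) ℝ :=
    Matrix.of fun k j => (mfderiv I3 I3 φ x (e k) : Fin 3 → ℝ) j with hM
  have h1 : M * comp2 h.toFun φ y * M.transpose
      = Matrix.diagonal fun i : Fin 3 => if i = 2 then (-1 : ℝ) else 1 := by
    ext a b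
    have h2 := he a b
    rw [← sum_coordVec hφ (φ.map_target hy) (e a), ← sum_coordVec hφ (φ.map_target hy) (e b)] at h2
    rw [Matrix.diagonal_apply, ← h2]
    simp only [Matrix.mul_apply, comp2, Matrix.of_apply, Matrix.transpose_apply, map_sum, map_smul,
      sum_apply, smul_apply, smul_eq_mul, Finset.sum_mul,
      Finset.mul_sum, hM]
    exact Finset.sum_congr rfl fun j _ => Finset.sum_congr rfl fun i _ => mul_comm _ _
  intro h0
  have := congrArg Matrix.det h1
  rw [Matrix.det_mul, Matrix.det_mul, h0, Matrix.det_diagonal] at this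
  simp at this

lemma isKKData_of_chart (hφ : φ ∈ charts W) (h : LorentzMetric W) (A : OneForm W) {V : W → ℝ}
    (hV : ContMDiff I3 𝓘(ℝ, ℝ) ∞ V) (hpos : ∀ x, 0 < V x) :
    IsKKData φ.target (comp2 h.toFun φ) (fun y => Real.log (V (φ.symm y)))
      (comp1 A.toFun φ) where
  isOpen := φ.open_target
  metric := h.smooth φ hφ
  -- Symmetry is demanded at every `y`, even off the chart target; it holds there too, since h is
  -- symmetric on whatever vectors `coordVec` returns.
  symm y i j := h.symm _ _ _
  det y hy := det_comp2_ne_zero h hφ hy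
  scalar := by
    refine ContDiffOn.log ?_ fun y _ => (hpos _).ne'
    have h1 : ContMDiffOn I3 I3 ∞ φ.symm φ.target := contMDiffOn_symm_of_mem_maximalAtlas hφ
    exact contMDiffOn_iff_contDiffOn.mp (hV.comp_contMDiffOn h1)
  potential := A.smooth φ hφ

lemma gMetric_eq_kkPull (h : LorentzMetric W) (A : OneForm W) {V : W → ℝ} (hpos : ∀ x, 0 < V x) :
    gMetric h V A φ = kkPull (-1) (comp2 h.toFun φ) (fun y => Real.log (V (φ.symm y)))
      (comp1 A.toFun φ) := by
  ext q a b
  rcases a with a | a <;> rcases b with b | b <;>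
    simp [gMetric, kkMetric, Real.exp_neg, Real.exp_log (hpos _), sub_eq_add_neg]

lemma GMetric_eq_kkPull (h : LorentzMetric W) {V : W → ℝ} (hpos : ∀ x, 0 < V x) :
    GMetric h V φ = kkPull 1 (comp2 h.toFun φ)
      (fun y => 1 / 2 * Real.log (V (φ.symm y))) 0 := by
  have h1 : ∀ x, Real.exp (1 / 2 * Real.log (V x)) = Real.sqrt (V x) := fun x => by
    rw [mul_comm, mul_one_div, Real.exp_half, Real.exp_log (hpos x)]
  ext q a b
  rcases a with a | a <;> rcases b with b | b <;>
    simp only [GMetric, kkPull, kkMetric, Real.exp_neg, h1, Matrix.fromBlocks_apply₁₁,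
      Matrix.fromBlocks_apply₁₂, Matrix.fromBlocks_apply₂₁, Matrix.fromBlocks_apply₂₂] <;> simp

end Charts

end EWKK

end

open EWKK in
theorem proposition1 {W : Type*} [TopologicalSpace W] [ChartedSpace (Fin 3 → ℝ) W]
    [IsManifold I3 ∞ W] (o : OrientationForm W) (S : EinsteinWeylStructure W)
    (V : WeightedFunction S (-1)) (A : OneForm W) (hmono : IsMonopole S o V A)
    (h : S.cls) (w : OneForm W) (hw : WeylCompatible S.D h.1 w)
    (hpos : ∀ x, 0 < V.toFun h x) (hflat : IsRicciFlat h.1 (V.toFun h) A) :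
    ∀ φ ∈ charts W,
      IsEMDSolution (1 / 4) (2 * Real.sqrt 3)
        (GMetric h.1 (V.toFun h) φ) (dilatonField (V.toFun h) φ)
        (pullTwoForm (hodge o h.1 (V.weylDeriv h w) φ)) (prodDomain φ) := by
  intro φ hφ
  rw [GMetric_eq_kkPull h.1 hpos]
  refine (isKKData_of_chart hφ h.1 A (V.smooth h) hpos).isEMDSolution (fun y hy i j => ?_)
    fun q hq a b => ?_
  -- The monopole equation replaces the Hodge dual by dA, whose components are `curl` by definition.
  · rw [hmono h w hw φ hφ y hy]
    rfl
  · rw [← gMetric_eq_kkPull h.1 A hpos]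
    exact hflat φ hφ q hq a b
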